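/- Theorem (The $n$-invariants principle). Let $M$ be a connected smooth manifold of dimension $n$ (Hausdorff, $\sigma$-compact), let $\mathrm{Diff}_k(M)$ be the scalar linear differential operators on $M$ of order at most $k$, i.e. the sections of a vector bundle $\psi_k$ over $M$, and let $J^l(\psi_k)$ be the space of $l$-jets $[A]^l_a$ of operators $A\in\mathrm{Diff}_k(M)$ at points $a\in M$. In local coordinates $x$ on $M$, with $A=\sum_{|\alpha|\le k}A_\alpha\partial^\alpha$, it has the coordinates $(x,u_{\alpha,\beta})$, $u_{\alpha,\beta}=\partial^\beta A_\alpha$, $|\alpha|\le k$, $|\beta|\le l$. For a function $I$ on a domain of $J^l(\psi_k)$ write $I(A)$ for the function $a\mapsto I([A]^l_a)$. A natural invariant on a domain is a smooth function on it that is invariant under the action $[A]_a\mapsto[\varphi_*A]_{\varphi(a)}$ of local diffeomorphisms $\varphi$ of $M$; a rational natural invariant is an invariant function which on every fibre of $J^r(\psi_k)\to M$ (for some $r$) is a rational function of the $u_{\alpha,\beta}$, defined where its denominator does not vanish. Let $I_1,\dots,I_n$ be natural invariants on an open set $\mathcal O\subset J^l(\psi_k)$ in general position there: $\widehat dI_1\wedge\dots\wedge\widehat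 dI_n\ne0$ on $\mathcal O$, i.e. $dI_1(A),\dots,dI_n(A)$ are linearly independent at $a$ whenever $[A]^l_a\in\mathcal O$. Let $$J_\alpha=\frac1{\alpha!}\,\square(I^\alpha),\qquad I^\alpha=I_1^{\alpha_1}\cdots I_n^{\alpha_n},\qquad|\alpha|\le k,$$ where $\square$ is the universal differential operator, $\square(f)([A]_a)=A\big(f(A)\big)(a)$, and let the Tresse derivatives $df/dI_i$ be defined by $df(A)=\sum_i\frac{df}{dI_i}(A)\,dI_i(A)$. Then over $\mathcal O$ every rational natural invariant $f$ of operators of order at most $k$, of any jet order $r$, is a rational function of $I_1,\dots,I_n$, the $J_\alpha$, $|\alpha|\le k$, and the iterated Tresse derivatives of the $J_\alpha$. Precisely, there are polynomials $P$ and $Q\ne0$ with real coefficients in finitely many of these functions such that $Q\neq0$ and $f=P/Q$ at $[A]_a$ for all $A\in\mathrm{Diff}_k(M)$ and $a\in M$ such that $[A]^l_a\in\mathcal O$ and $[A]^r_a$ is in the domain of $f$. -/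

import Mathlib

open scoped Manifold ContDiff Topology

noncomputable section

namespace NaturalInvariants

/-- Multi-indices in `n` variables of length at most `k`. -/
abbrev Idx (n k : ℕ) : Type := {α : Fin n → ℕ // ∑ i, α i ≤ k}

instance (n k : ℕ) : Finite (Idx n k) := by
  refine Finite.of_injective
    (fun (α : Idx n k) (i : Fin n) =>
      (⟨α.1 i, Nat.lt_succ_of_le
        ((Finset.single_le_sum (fun j _ => Nat.zero_le (α.1 j)) (Finset.mem_univ i)).trans α.2)⟩ :
        Fin (k + 1))) ?_
  intro α β h
  apply Subtype.ext
  funext i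
  exact congrArg Fin.val (congrFun h i)

instance (n k : ℕ) : Fintype (Idx n k) := Fintype.ofFinite _

/-! ### Partial derivatives on `ℝⁿ` -/

/-- The partial derivative `∂f/∂xᵢ`. -/
def pd {n : ℕ} (i : Fin n) (f : EuclideanSpace ℝ (Fin n) → ℝ) :
    EuclideanSpace ℝ (Fin n) → ℝ :=
  fun x => fderiv ℝ f x (EuclideanSpace.single i 1)

/-- The iterated partial derivative `∂^β f`. -/
def mpd {n : ℕ} (β : Fin n → ℕ) (f : EuclideanSpace ℝ (Fin n) → ℝ) :
    EuclideanSpace ℝ (Fin n) → ℝ :=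
  (List.finRange n).foldr (fun i g => (pd i)^[β i] g) f

section Manifold

variable (n k l : ℕ) (M : Type*) [TopologicalSpace M] [ChartedSpace (EuclideanSpace ℝ (Fin n)) M]

/-- The algebra `C^∞(M)`. -/
abbrev Smooth : Type _ := C^∞⟮𝓡 n, M; 𝓘(ℝ, ℝ), ℝ⟯

variable {n M}

/-! ### Linear differential operators -/

/-- The commutator `[A, f] = A ∘ f - f ∘ A` with the multiplication by `f`. -/
def comm (A : Smooth n M →ₗ[ℝ] Smooth n M) (f : Smooth n M) : Smooth n M →ₗ[ℝ] Smooth n M :=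
  A ∘ₗ LinearMap.mulLeft ℝ f - LinearMap.mulLeft ℝ f ∘ₗ A

/-- `A` is a linear differential operator of order at most `k`: all `(k+1)`-fold commutators
with functions vanish. -/
def HasOrderLE : ℕ → (Smooth n M →ₗ[ℝ] Smooth n M) → Prop
  | 0, A => ∀ f, comm A f = 0
  | k + 1, A => ∀ f, HasOrderLE k (comm A f)

variable (n M) in
/-- `Diff_k(M)`: scalar linear differential operators of order at most `k` on `M`. -/
abbrev DiffOp : Type _ := {A : Smooth n M →ₗ[ℝ] Smooth n M // HasOrderLE k A}

open Classical in
/-- The value at `a` of `A g`, where `g` is smooth near `a` only: `A` is applied to any global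
smooth function with the same germ at `a`. -/
def localApp (A : Smooth n M →ₗ[ℝ] Smooth n M) (g : M → ℝ) (a : M) : ℝ :=
  if h : ∃ G : Smooth n M, (G : M → ℝ) =ᶠ[𝓝 a] g then A h.choose a else 0

/-- Differential operators are local. -/
theorem apply_eq_zero_of_germ [T2Space M] [IsManifold (𝓡 n) ∞ M] (k : ℕ) :
    ∀ (A : Smooth n M →ₗ[ℝ] Smooth n M), HasOrderLE k A → ∀ (G : Smooth n M) (a : M),
      (∀ᶠ p in 𝓝 a, G p = 0) → A G a = 0 := by
  have key : ∀ (A : Smooth n M →ₗ[ℝ] Smooth n M) (G : Smooth n M) (a : M),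
      (∀ᶠ p in 𝓝 a, G p = 0) → ∃ b : Smooth n M, A G a = -(comm A b G a) := by
    intro A G a h
    obtain ⟨φ, -, hφ⟩ := (SmoothBumpFunction.nhds_basis_support (I := 𝓡 n)
      (s := {p | G p = 0}) h).mem_iff.1 h
    let b : Smooth n M := ⟨φ, φ.contMDiff⟩
    have hb : b * G = 0 := by
      ext p
      by_cases hp : p ∈ Function.support φ
      · have : G p = 0 := hφ hp
        simp [this]
      · have : φ p = 0 := by simpa using hp
        change φ p * G p = 0
        simp [this]
    have hb1 : b a = 1 := φ.eq_one
    refine ⟨b, ?_⟩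
    simp [comm, hb, hb1]
  induction k with
  | zero =>
    intro A hA G a h
    obtain ⟨b, hb⟩ := key A G a h
    rw [hb, hA b]
    simp
  | succ k ih =>
    intro A hA G a h
    obtain ⟨b, hb⟩ := key A G a h
    rw [hb, ih _ (hA b) G a h]
    simp

/-- The choice made in `localApp` does not matter. -/
theorem localApp_eq [T2Space M] [IsManifold (𝓡 n) ∞ M] (A : DiffOp n k M) (g : M → ℝ) (a : M)
    (G : Smooth n M) (hG : (G : M → ℝ) =ᶠ[𝓝 a] g) : localApp A.1 g a = A.1 G a := by
  have h : ∃ G : Smooth n M, (G : M → ℝ) =ᶠ[𝓝 a] g := ⟨G, hG⟩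
  rw [localApp, dif_pos h]
  have h0 := apply_eq_zero_of_germ k A.1 A.2 (h.choose - G) a (by
    filter_upwards [h.choose_spec, hG] with p h1 h2
    simp [h1, h2])
  rw [map_sub] at h0
  exact sub_eq_zero.1 h0

/-! ### Jets of operators -/

/-- The coefficient `A_α` of `A = ∑ A_α ∂^α` in the chart `χ`, as a function on the image of
`χ`: its value at `x` is `(1/α!) A((χ - x)^α)` at the point with coordinates `x`. -/
def coeff (χ : OpenPartialHomeomorph M (EuclideanSpace ℝ (Fin n)))
    (A : Smooth n M →ₗ[ℝ] Smooth n M) (α : Fin n → ℕ) : EuclideanSpace ℝ (Fin n) → ℝ :=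
  fun x => (∏ i, ((α i).factorial : ℝ))⁻¹ *
    localApp A (fun p => ∏ i, (χ p i - x i) ^ α i) (χ.symm x)

variable {k}

/-- The fibre coordinates `u_{α,β}` (`|α| ≤ k`, `|β| ≤ l`) of the `l`-jet of `A` at `a` in the
chart `χ`. -/
def jetCoord (χ : OpenPartialHomeomorph M (EuclideanSpace ℝ (Fin n)))
    (A : DiffOp n k M) (a : M) : Idx n k × Idx n l → ℝ :=
  fun αβ => mpd αβ.2.1 (coeff χ A.1 αβ.1.1) (χ a)

variable (n k M) in
/-- Pairs (operator, point) define the same `l`-jet if the points are equal and the coefficients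
have the same partial derivatives up to order `l` there. -/
def jetSetoid : Setoid (DiffOp n k M × M) where
  r s t := s.2 = t.2 ∧ ∀ χ ∈ IsManifold.maximalAtlas (𝓡 n) ∞ M, s.2 ∈ χ.source →
    jetCoord l χ s.1 s.2 = jetCoord l χ t.1 s.2
  iseqv :=
    { refl := fun _ => ⟨rfl, fun _ _ _ => rfl⟩
      symm := by
        rintro ⟨A, a⟩ ⟨B, b⟩ ⟨rfl, h⟩
        exact ⟨rfl, fun χ hχ hs => (h χ hχ hs).symm⟩
      trans := by
        rintro ⟨A, a⟩ ⟨B, b⟩ ⟨C, c⟩ ⟨rfl, h⟩ ⟨rfl, h'⟩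
        exact ⟨rfl, fun χ hχ hs => (h χ hχ hs).trans (h' χ hχ hs)⟩ }

variable (n k M) in
/-- The total space `J^l(ψ_k)` of the bundle of `l`-jets of operators of order at most `k`. -/
def JetSpace : Type _ := Quotient (jetSetoid n k l M)

/-- The `l`-jet `[A]_a^l`. -/
def jet (A : DiffOp n k M) (a : M) : JetSpace n k l M := Quotient.mk (jetSetoid n k l M) (A, a)

variable {l}

/-- `O` is an open subset of `J^l(ψ_k)`: open in the coordinates `(x, u_{α,β})`. -/
def IsOpenJet (O : Set (JetSpace n k l M)) : Prop :=
  ∀ χ ∈ IsManifold.maximalAtlas (𝓡 n) ∞ M,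
    ∃ V : Set (EuclideanSpace ℝ (Fin n) × (Idx n k × Idx n l → ℝ)), IsOpen V ∧
      ∀ (A : DiffOp n k M), ∀ a ∈ χ.source,
        (jet l A a ∈ O ↔ (χ a, jetCoord l χ A a) ∈ V)

/-- `f` is a smooth function on the subset `O` of `J^l(ψ_k)`: in the coordinates `(x, u_{α,β})`
of every chart, `O` corresponds to an open set, on which `f` is smooth. The values of `f` outside
`O` play no role. -/
def SmoothOnJet (f : JetSpace n k l M → ℝ) (O : Set (JetSpace n k l M)) : Prop :=
  ∀ χ ∈ IsManifold.maximalAtlas (𝓡 n) ∞ M,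
    ∃ (V : Set (EuclideanSpace ℝ (Fin n) × (Idx n k × Idx n l → ℝ)))
      (F : EuclideanSpace ℝ (Fin n) × (Idx n k × Idx n l → ℝ) → ℝ),
      IsOpen V ∧ ContDiffOn ℝ ∞ F V ∧
      ∀ (A : DiffOp n k M), ∀ a ∈ χ.source,
        (jet l A a ∈ O ↔ (χ a, jetCoord l χ A a) ∈ V) ∧
        (jet l A a ∈ O → f (jet l A a) = F (χ a, jetCoord l χ A a))

/-! ### The pseudogroup of local diffeomorphisms and natural invariants -/

/-- Local diffeomorphisms of `M`. -/
def IsLocalDiffeo (φ : OpenPartialHomeomorph M M) : Prop :=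
  ContMDiffOn (𝓡 n) (𝓡 n) ∞ φ φ.source ∧ ContMDiffOn (𝓡 n) (𝓡 n) ∞ φ.symm φ.target

/-- `B` equals `φ_* A` on the target of `φ`: `(B g) ∘ φ = A (g ∘ φ)` on the source of `φ`. -/
def IsPushforward (φ : OpenPartialHomeomorph M M) (A B : DiffOp n k M) : Prop :=
  ∀ g : Smooth n M, ∀ p ∈ φ.source, B.1 g (φ p) = localApp A.1 (g ∘ φ) p

/-- `f`, as a function on `O ⊆ J^l(ψ_k)`, is invariant under the lifted action
`[A]_a ↦ [φ_* A]_{φ(a)}` of local diffeomorphisms. -/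
def InvariantOn (f : JetSpace n k l M → ℝ) (O : Set (JetSpace n k l M)) : Prop :=
  ∀ φ : OpenPartialHomeomorph M M, IsLocalDiffeo (n := n) φ →
    ∀ A B : DiffOp n k M, IsPushforward φ A B → ∀ a ∈ φ.source,
      jet l A a ∈ O → jet l B (φ a) ∈ O → f (jet l A a) = f (jet l B (φ a))

/-- (Smooth) natural `l`-invariants of differential operators on `O ⊆ J^l(ψ_k)`. -/
def IsNaturalInvariantOn (f : JetSpace n k l M → ℝ) (O : Set (JetSpace n k l M)) : Prop :=
  SmoothOnJet f O ∧ InvariantOn f O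

/-- `f`, with domain of definition `D ⊆ J^l(ψ_k)`, is a rational function along the fibres of
`J^l(ψ_k) → M`: on every fibre it is a quotient of two polynomials in the `u_{α,β}`, defined where
the denominator (not the zero polynomial) does not vanish. -/
def IsRationalAlongFibres (f : JetSpace n k l M → ℝ) (D : Set (JetSpace n k l M)) : Prop :=
  ∀ χ ∈ IsManifold.maximalAtlas (𝓡 n) ∞ M, ∀ a ∈ χ.source,
    ∃ P Q : MvPolynomial (Idx n k × Idx n l) ℝ, Q ≠ 0 ∧
      ∀ A : DiffOp n k M,
        (jet l A a ∈ D ↔ MvPolynomial.eval (jetCoord l χ A a) Q ≠ 0) ∧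
        (jet l A a ∈ D → f (jet l A a) =
          MvPolynomial.eval (jetCoord l χ A a) P / MvPolynomial.eval (jetCoord l χ A a) Q)

/-- Rational natural `l`-invariants of operators of order at most `k`, with domain of
definition `D`. -/
def IsRationalNaturalInvariant (f : JetSpace n k l M → ℝ) (D : Set (JetSpace n k l M)) : Prop :=
  IsRationalAlongFibres f D ∧ InvariantOn f D

/-! ### Universal operator and Tresse derivatives

A function on a jet space `J^r(ψ_k)`, `r` arbitrary, is written as the nonlinear differential
operator that it defines, which sends `A` to the function `a ↦ f([A]_a^r)` on `M`. -/

/-- The nonlinear differential operator `Δ_f : A ↦ (j_l A)^* f` of a function `f` on `J^l(ψ_k)`. -/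
def restrict (f : JetSpace n k l M → ℝ) : DiffOp n k M → M → ℝ := fun A a => f (jet l A a)

/-- The universal differential operator: the value of `□ f` at `[A]_a` is the value at `a` of `A`
applied to the restriction of `f` to `A`. -/
def box (f : DiffOp n k M → M → ℝ) : DiffOp n k M → M → ℝ := fun A a => localApp A.1 (f A) a

/-- The differential of a function at a point, as a covector. -/
def dAt (f : M → ℝ) (a : M) : TangentSpace (𝓡 n) a →L[ℝ] ℝ := mfderiv (𝓡 n) 𝓘(ℝ, ℝ) f a

/-- The total differentials of `I₁, …, Iₙ` (`n = dim M`) are linearly independent, that is,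
have a nonzero wedge product, at all points of `O`. -/
def GeneralPosition (I : Fin n → JetSpace n k l M → ℝ) (O : Set (JetSpace n k l M)) : Prop :=
  ∀ (A : DiffOp n k M) (a : M), jet l A a ∈ O →
    LinearIndependent ℝ (fun i => dAt (n := n) (restrict (I i) A) a)

open Classical in
/-- The Tresse derivative `df/dIᵢ`: the coefficient in `d̂f = ∑ⱼ (df/dIⱼ) d̂Iⱼ`. -/
def tresse (I : Fin n → DiffOp n k M → M → ℝ) (i : Fin n) (f : DiffOp n k M → M → ℝ) :
    DiffOp n k M → M → ℝ :=
  fun A a =>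
    if h : ∃ t : Fin n → ℝ, dAt (n := n) (f A) a = ∑ j, t j • dAt (n := n) (I j A) a then h.choose i else 0

/-- Iterated Tresse derivatives. -/
def tresseIter (I : Fin n → DiffOp n k M → M → ℝ) (w : List (Fin n))
    (f : DiffOp n k M → M → ℝ) : DiffOp n k M → M → ℝ :=
  w.foldr (tresse I) f

/-- `J_α = (1/α!) □(I^α)`. -/
def J (I : Fin n → DiffOp n k M → M → ℝ) (α : Fin n → ℕ) : DiffOp n k M → M → ℝ :=
  fun A a => (∏ i, ((α i).factorial : ℝ))⁻¹ * box (fun A p => ∏ i, I i A p ^ α i) A a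

/-- The basic invariants: `Iᵢ`, and the iterated Tresse derivatives (of all orders, including
order zero) of `J_α`, `|α| ≤ k`. -/
def basicInvariant (I : Fin n → DiffOp n k M → M → ℝ) :
    Fin n ⊕ (Idx n k × List (Fin n)) → DiffOp n k M → M → ℝ
  | Sum.inl i => I i
  | Sum.inr (α, w) => tresseIter I w (J I α.1)

end Manifold

end NaturalInvariants

end

open NaturalInvariants

/-!
# The `n`-invariants principle

Near a point `a` with `[A]_a ∈ O` the functions `Iᵢ(A)` have linearly independent differentials, so
after adding constants they are the coordinates of a chart `χ`
(`exists_chart_of_linearIndependent_dAt`), and the constants can be chosen to give `χ a` any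
prescribed value. Two facts about this chart make the theorem true.

In `χ` the coefficients of `A` are polynomials in the `Iᵢ` and the `J_β`: expand
`(1/α!) A((χ - χ(q))^α)` at `q` by the binomial theorem. The partial derivatives along `χ` are the
Tresse derivatives (`tresse_eq_pd`), which act on polynomials in the basic invariants by a formal
derivation. Hence the fibre coordinates `u_{α,β}` of the jet of `A` in `χ` are polynomials in the
basic invariants that do not depend on `A` and `a` (`jetCoord_eq_eval_jetPoly`).

On the other hand, fix a point `a₀` with a chart `χ₀` and write `f` on the fibre over `a₀` as a
reduced fraction `P / Q` in the coordinates of `χ₀`. If `χ a = χ₀ a₀`, then `χ₀⁻¹ ∘ χ` is a local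
diffeomorphism from `a` to `a₀` that identifies the fibre coordinates, and every vector of
coordinates comes from an operator near `a` and its push-forward near `a₀`
(`exists_isPushforward_jetCoord_eq`). Invariance of `f` says that its fraction on the fibre over `a`
agrees with `P / Q` where both are defined. The domain `D` need not be invariant, so this leaves
open whether `Q` vanishes at a given jet in `D`; but as `P / Q` is reduced, `Q` divides the
denominator over `a`, and therefore `f = P / Q` on all of `D`
(`IsRationalNaturalInvariant.exists_eval_jetCoord`).

Substituting the polynomials of the first fact into the fraction of the second gives the result.
-/

open NaturalInvariants
noncomputable section

namespace NaturalInvariants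

/-! ### Partial derivatives on Euclidean space -/

section

/-- The operator `op₁^{β₁} ⋯ opₙ^{βₙ}`, composed in the order of `mpd`; the operators need not
commute. -/
def multiIter {X : Type*} {n : ℕ} (op : Fin n → X → X) (β : Fin n → ℕ) (x : X) : X :=
  (List.finRange n).foldr (fun i y => (op i)^[β i] y) x

/-- A relation respected by the operators of two families is respected by their iterates. Since
`mpd β` is `multiIter pd β`, this transports iterated partial derivatives to germs, to polynomials,
to differential operators and to Tresse derivatives. -/
theorem multiIter_rel {X Y : Type*} {n : ℕ} {op : Fin n → X → X} {op' : Fin n → Y → Y}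
    (R : X → Y → Prop) (h : ∀ i x y, R x y → R (op i x) (op' i y)) (β : Fin n → ℕ)
    {x : X} {y : Y} (hxy : R x y) : R (multiIter op β x) (multiIter op' β y) := by
  unfold multiIter
  induction List.finRange n with
  | nil => exact hxy
  | cons i L ih =>
    simp only [List.foldr_cons]
    generalize β i = b
    induction b with
    | zero => exact ih
    | succ b ihb =>
      rw [Function.iterate_succ_apply', Function.iterate_succ_apply']
      exact h _ _ _ ihb

variable {n : ℕ}

theorem pd_congr {f g : EuclideanSpace ℝ (Fin n) → ℝ} {x : EuclideanSpace ℝ (Fin n)} (i : Fin n)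
    (h : f =ᶠ[𝓝 x] g) : pd i f =ᶠ[𝓝 x] pd i g := by
  filter_upwards [h.fderiv (𝕜 := ℝ)] with y hy
  simp [pd, hy]

theorem mpd_congr {f g : EuclideanSpace ℝ (Fin n) → ℝ} {x : EuclideanSpace ℝ (Fin n)}
    (β : Fin n → ℕ) (h : f =ᶠ[𝓝 x] g) : mpd β f =ᶠ[𝓝 x] mpd β g :=
  multiIter_rel (fun f g => f =ᶠ[𝓝 x] g) (fun i _ _ h => pd_congr i h) β h

theorem contDiffOn_pd {f : EuclideanSpace ℝ (Fin n) → ℝ} {N : Set (EuclideanSpace ℝ (Fin n))}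
    (hN : IsOpen N) (hf : ContDiffOn ℝ ∞ f N) (i : Fin n) : ContDiffOn ℝ ∞ (pd i f) N :=
  (hf.fderiv_of_isOpen hN (by simp)).clm_apply contDiffOn_const

theorem contDiffOn_mpd {f : EuclideanSpace ℝ (Fin n) → ℝ} {N : Set (EuclideanSpace ℝ (Fin n))}
    (hN : IsOpen N) (hf : ContDiffOn ℝ ∞ f N) (β : Fin n → ℕ) : ContDiffOn ℝ ∞ (mpd β f) N :=
  multiIter_rel
    (fun (f : EuclideanSpace ℝ (Fin n) → ℝ) (_ : Unit) => ContDiffOn ℝ ∞ f N) (op' := fun _ => id)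
    (fun i _ _ h => contDiffOn_pd hN h i) β (y := ()) hf

theorem pd_add {f g : EuclideanSpace ℝ (Fin n) → ℝ} {x : EuclideanSpace ℝ (Fin n)}
    (hf : DifferentiableAt ℝ f x) (hg : DifferentiableAt ℝ g x) (i : Fin n) :
    pd i (f + g) x = pd i f x + pd i g x := by
  simp [pd, fderiv_add hf hg]

theorem pd_mul {f g : EuclideanSpace ℝ (Fin n) → ℝ} {x : EuclideanSpace ℝ (Fin n)}
    (hf : DifferentiableAt ℝ f x) (hg : DifferentiableAt ℝ g x) (i : Fin n) :
    pd i (f * g) x = f x * pd i g x + g x * pd i f x := by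
  simp [pd, fderiv_mul hf hg]

theorem pd_const_smul (c : ℝ) (f : EuclideanSpace ℝ (Fin n) → ℝ) (x : EuclideanSpace ℝ (Fin n))
    (i : Fin n) : pd i (c • f) x = c * pd i f x := by
  simp [pd, fderiv_const_smul_field]

/-- The polynomial `p` as a function of the increment `x - c`. -/
def polyAt (c : EuclideanSpace ℝ (Fin n)) (p : MvPolynomial (Fin n) ℝ)
    (x : EuclideanSpace ℝ (Fin n)) : ℝ :=
  MvPolynomial.eval (fun i => x i - c i) p

theorem hasFDerivAt_polyAt (c : EuclideanSpace ℝ (Fin n)) (p : MvPolynomial (Fin n) ℝ)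
    (x : EuclideanSpace ℝ (Fin n)) :
    HasFDerivAt (polyAt c p)
      (∑ i, polyAt c (MvPolynomial.pderiv i p) x •
        (EuclideanSpace.proj i : EuclideanSpace ℝ (Fin n) →L[ℝ] ℝ)) x := by
  induction p using MvPolynomial.induction_on with
  | C a =>
    refine ((hasFDerivAt_const (𝕜 := ℝ) a x).congr_fderiv ?_).congr_of_eventuallyEq ?_
    · simp [polyAt]
    · exact Filter.Eventually.of_forall fun y => by simp [polyAt]
  | add p q hp hq =>
    have := hp.add hq
    rw [← Finset.sum_add_distrib] at this
    refine (this.congr_fderiv ?_).congr_of_eventuallyEq ?_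
    · simp [polyAt, add_smul]
    · exact Filter.Eventually.of_forall fun y => by simp [polyAt]
  | mul_X p j hp =>
    have hj : HasFDerivAt (fun y : EuclideanSpace ℝ (Fin n) => y j - c j)
        (EuclideanSpace.proj j : EuclideanSpace ℝ (Fin n) →L[ℝ] ℝ) x :=
      (EuclideanSpace.proj j : EuclideanSpace ℝ (Fin n) →L[ℝ] ℝ).hasFDerivAt.sub_const (c j)
    refine ((hp.mul hj).congr_fderiv ?_).congr_of_eventuallyEq ?_
    · ext v
      simp [polyAt, MvPolynomial.pderiv_X, Pi.single_apply, add_mul, Finset.sum_add_distrib,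
        Finset.mul_sum, apply_ite, mul_assoc]
    · exact Filter.Eventually.of_forall fun y => by simp [polyAt]

theorem pd_polyAt (c : EuclideanSpace ℝ (Fin n)) (p : MvPolynomial (Fin n) ℝ) (i : Fin n) :
    pd i (polyAt c p) = polyAt c (MvPolynomial.pderiv i p) := by
  funext x
  rw [pd, (hasFDerivAt_polyAt c p x).fderiv]
  simp

theorem mpd_polyAt (c : EuclideanSpace ℝ (Fin n)) (p : MvPolynomial (Fin n) ℝ) (β : Fin n → ℕ) :
    mpd β (polyAt c p) = polyAt c (multiIter (fun i => MvPolynomial.pderiv i) β p) :=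
  multiIter_rel (fun f p => f = polyAt c p) (fun i _ p h => by rw [h, pd_polyAt]) β rfl

theorem contDiff_polyAt (c : EuclideanSpace ℝ (Fin n)) (p : MvPolynomial (Fin n) ℝ) :
    ContDiff ℝ ∞ (polyAt c p) := by
  unfold polyAt
  simp only [MvPolynomial.eval_eq]
  fun_prop

theorem coeff_iterate_pderiv (i : Fin n) (b : ℕ) (p : MvPolynomial (Fin n) ℝ) (m : Fin n →₀ ℕ) :
    MvPolynomial.coeff m ((MvPolynomial.pderiv i)^[b] p) =
      MvPolynomial.coeff (m + Finsupp.single i b) p * ((m i + 1).ascFactorial b : ℝ) := by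
  induction b generalizing m with
  | zero => simp
  | succ b ih =>
    rw [Function.iterate_succ_apply', MvPolynomial.coeff_pderiv, ih, add_assoc,
      ← Finsupp.single_add, add_comm 1 b]
    have h := Nat.succ_ascFactorial (m i + 1) b
    rw [← Nat.ascFactorial_succ] at h
    rw [← h]
    simp [mul_comm, mul_left_comm]

/-- The value at the origin of an iterated partial derivative of a polynomial. -/
theorem coeff_multiIter_pderiv (β : Fin n → ℕ) (p : MvPolynomial (Fin n) ℝ) :
    MvPolynomial.constantCoeff (multiIter (fun i => MvPolynomial.pderiv i) β p) =
      MvPolynomial.coeff (Finsupp.equivFunOnFinite.symm β) p * ∏ i, ((β i).factorial : ℝ) := by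
  -- Along a list without repetitions, an exponent not yet differentiated is still `0`, so that each
  -- variable contributes a full factorial.
  have key : ∀ L : List (Fin n), L.Nodup → ∀ m : Fin n →₀ ℕ, (∀ i ∈ L, m i = 0) →
      MvPolynomial.coeff m
          (L.foldr (fun i y => (MvPolynomial.pderiv (R := ℝ) i)^[β i] y) p) =
        MvPolynomial.coeff (m + (L.map fun i => Finsupp.single i (β i)).sum) p *
          (L.map fun i => ((β i).factorial : ℝ)).prod := by
    intro L
    induction L with
    | nil => simp
    | cons i L ih =>
      intro hL m hm
      rw [List.nodup_cons] at hL
      rw [List.foldr_cons, coeff_iterate_pderiv, ih hL.2]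
      · simp [hm i (by simp), Nat.one_ascFactorial, add_assoc, mul_comm, mul_left_comm]
      · intro j hj
        have : j ≠ i := fun h => hL.1 (h ▸ hj)
        simp [hm j (by simp [hj]), this]
  rw [MvPolynomial.constantCoeff_eq, multiIter, key _ (List.nodup_finRange n) 0 (by simp)]
  have h1 : (0 + ((List.finRange n).map fun i => Finsupp.single i (β i)).sum : Fin n →₀ ℕ) =
      Finsupp.equivFunOnFinite.symm β := by
    rw [zero_add, ← List.ofFn_eq_map, List.sum_ofFn]
    ext j
    simp [Finsupp.finsetSum_apply, Finsupp.single_apply]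
  rw [h1, ← List.ofFn_eq_map, List.prod_ofFn]

/-- Taylor's formula for polynomials. -/
theorem mpd_polyAt_self (c : EuclideanSpace ℝ (Fin n)) (p : MvPolynomial (Fin n) ℝ)
    (β : Fin n → ℕ) :
    mpd β (polyAt c p) c =
      MvPolynomial.coeff (Finsupp.equivFunOnFinite.symm β) p * ∏ i, ((β i).factorial : ℝ) := by
  rw [mpd_polyAt, ← coeff_multiIter_pderiv]
  simp only [polyAt, sub_self]
  rw [MvPolynomial.eval_zero']

end

/-! ### Locality of differential operators -/

section

variable {n k : ℕ} {M : Type*} [TopologicalSpace M] [ChartedSpace (EuclideanSpace ℝ (Fin n)) M]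

/-- Near each point, a function smooth on an open set is the germ of a global smooth function, as
`localApp` requires. -/
theorem exists_smooth_eventuallyEq [T2Space M] [IsManifold (𝓡 n) ∞ M] {g : M → ℝ} {U : Set M}
    (hU : IsOpen U) (hg : ContMDiffOn (𝓡 n) 𝓘(ℝ, ℝ) ∞ g U) {a : M} (ha : a ∈ U) :
    ∃ G : Smooth n M, (G : M → ℝ) =ᶠ[𝓝 a] g := by
  obtain ⟨φ, -, hφ⟩ := (SmoothBumpFunction.nhds_basis_tsupport (I := 𝓡 n) a).mem_iff.1
    (hU.mem_nhds ha)
  refine ⟨⟨fun p => φ p * g p, contMDiff_of_tsupport fun x hx => ?_⟩, ?_⟩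
  · have hx' : x ∈ U := hφ (tsupport_mul_subset_left hx)
    exact φ.contMDiff.contMDiffAt.mul (hg.contMDiffAt (hU.mem_nhds hx'))
  · filter_upwards [φ.eventuallyEq_one] with p hp
    simp [hp]

theorem contMDiffOn_localApp [T2Space M] [IsManifold (𝓡 n) ∞ M] (A : DiffOp n k M) {g : M → ℝ}
    {U : Set M} (hU : IsOpen U) (hg : ContMDiffOn (𝓡 n) 𝓘(ℝ, ℝ) ∞ g U) :
    ContMDiffOn (𝓡 n) 𝓘(ℝ, ℝ) ∞ (localApp A.1 g) U := by
  intro a ha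
  obtain ⟨G, hG⟩ := exists_smooth_eventuallyEq hU hg ha
  refine ContMDiffAt.contMDiffWithinAt ?_
  refine ((A.1 G).contMDiff a).congr_of_eventuallyEq ?_
  filter_upwards [hG.eventuallyEq_nhds] with p hp
  exact localApp_eq k A g p G hp

/-- Binomial expansion of a product of powers. -/
theorem prod_sub_pow {ι R : Type*} [Fintype ι] [DecidableEq ι] [CommRing R] (y c : ι → R)
    (α : ι → ℕ) :
    ∏ i, (y i - c i) ^ α i = ∑ β ∈ Fintype.piFinset fun i => Finset.range (α i + 1),
      (∏ i, ((-c i) ^ (α i - β i) * ((α i).choose (β i) : R))) * ∏ i, y i ^ β i := by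
  simp only [sub_eq_add_neg, add_pow]
  rw [Finset.prod_univ_sum]
  refine Finset.sum_congr rfl fun β _ => ?_
  rw [← Finset.prod_mul_distrib]
  exact Finset.prod_congr rfl fun i _ => by ring

/-- The values at `q` of a differential operator on the monomials in `y - c` are combinations of
those on the monomials in `y`. -/
theorem localApp_prod_sub_pow [T2Space M] [IsManifold (𝓡 n) ∞ M] {ι : Type*} [Fintype ι]
    [DecidableEq ι] (A : DiffOp n k M) {y : ι → M → ℝ} {U : Set M} (hU : IsOpen U)
    (hy : ∀ i, ContMDiffOn (𝓡 n) 𝓘(ℝ, ℝ) ∞ (y i) U) {q : M} (hq : q ∈ U) (c : ι → ℝ)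
    (α : ι → ℕ) :
    localApp A.1 (fun p => ∏ i, (y i p - c i) ^ α i) q =
      ∑ β ∈ Fintype.piFinset fun i => Finset.range (α i + 1),
        (∏ i, ((-c i) ^ (α i - β i) * ((α i).choose (β i) : ℝ))) *
          localApp A.1 (fun p => ∏ i, y i p ^ β i) q := by
  choose G hG using fun i => exists_smooth_eventuallyEq hU (hy i) hq
  have hG' : ∀ᶠ p in 𝓝 q, ∀ i, G i p = y i p := Filter.eventually_all.2 hG
  have heval : ∀ (β : ι → ℕ) (p : M), (∀ i, G i p = y i p) →
      (∏ i, G i ^ β i : Smooth n M) p = ∏ i, y i p ^ β i := fun β p hp => by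
    change ContMDiffMap.coeFnAlgHom (∏ i, G i ^ β i : Smooth n M) p = _
    rw [map_prod, Finset.prod_apply]
    exact Finset.prod_congr rfl fun i _ => by rw [map_pow, ← hp i]; rfl
  have hmon : ∀ β : ι → ℕ, localApp A.1 (fun p => ∏ i, y i p ^ β i) q =
      A.1 (∏ i, G i ^ β i) q := fun β => by
    refine localApp_eq k A _ q _ ?_
    filter_upwards [hG'] with p hp
    exact heval β p hp
  rw [localApp_eq k A _ q
    (∑ β ∈ Fintype.piFinset fun i => Finset.range (α i + 1),
        (∏ i, ((-c i) ^ (α i - β i) * ((α i).choose (β i) : ℝ))) • ∏ i, G i ^ β i)]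
  · rw [map_sum]
    simp only [map_smul, hmon]
    rw [← ContMDiffMap.coeFnAddMonoidHom_apply, map_sum, Finset.sum_apply]
    rfl
  · filter_upwards [hG'] with p hp
    rw [prod_sub_pow, ← ContMDiffMap.coeFnAddMonoidHom_apply, map_sum, Finset.sum_apply]
    refine Finset.sum_congr rfl fun β _ => ?_
    rw [← heval β p hp]
    rfl

/-! ### Charts -/

theorem comp_chart_symm_eventuallyEq {n : ℕ} {M : Type*} [TopologicalSpace M]
    {χ : OpenPartialHomeomorph M (EuclideanSpace ℝ (Fin n))}
    {g : M → ℝ} {F : EuclideanSpace ℝ (Fin n) → ℝ} {q : M} (hq : q ∈ χ.source)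
    (h : g =ᶠ[𝓝 q] F ∘ χ) : g ∘ χ.symm =ᶠ[𝓝 (χ q)] F := by
  filter_upwards [(χ.tendsto_symm hq).eventually h, χ.open_target.mem_nhds (χ.map_source hq)]
    with x hx hx'
  simpa [χ.right_inv hx'] using hx

theorem contMDiffOn_comp_chart [IsManifold (𝓡 n) ∞ M]
    {χ : OpenPartialHomeomorph M (EuclideanSpace ℝ (Fin n))}
    (hχ : χ ∈ IsManifold.maximalAtlas (𝓡 n) ∞ M) {F : EuclideanSpace ℝ (Fin n) → ℝ}
    (hF : ContDiffOn ℝ ∞ F χ.target) : ContMDiffOn (𝓡 n) 𝓘(ℝ, ℝ) ∞ (F ∘ χ) χ.source :=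
  hF.contMDiffOn.comp (contMDiffOn_of_mem_maximalAtlas hχ) χ.mapsTo

theorem contDiffOn_comp_chart_symm [IsManifold (𝓡 n) ∞ M]
    {χ : OpenPartialHomeomorph M (EuclideanSpace ℝ (Fin n))}
    (hχ : χ ∈ IsManifold.maximalAtlas (𝓡 n) ∞ M) {g : M → ℝ}
    (hg : ContMDiffOn (𝓡 n) 𝓘(ℝ, ℝ) ∞ g χ.source) : ContDiffOn ℝ ∞ (g ∘ χ.symm) χ.target :=
  (hg.comp (contMDiffOn_symm_of_mem_maximalAtlas hχ) χ.symm.mapsTo).contDiffOn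

theorem contMDiffOn_chart_coord [IsManifold (𝓡 n) ∞ M]
    {χ : OpenPartialHomeomorph M (EuclideanSpace ℝ (Fin n))}
    (hχ : χ ∈ IsManifold.maximalAtlas (𝓡 n) ∞ M) (i : Fin n) :
    ContMDiffOn (𝓡 n) 𝓘(ℝ, ℝ) ∞ (fun p => χ p i) χ.source :=
  contMDiffOn_comp_chart hχ (F := fun x => x i) (by fun_prop)

/-- By the binomial theorem, `coeff` is a combination, with polynomial coefficients in `x`, of the
values of `A` on the monomials in the coordinates, which no longer depend on `x`. -/
theorem contDiffOn_coeff [T2Space M] [IsManifold (𝓡 n) ∞ M]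
    {χ : OpenPartialHomeomorph M (EuclideanSpace ℝ (Fin n))}
    (hχ : χ ∈ IsManifold.maximalAtlas (𝓡 n) ∞ M) (A : DiffOp n k M) (α : Fin n → ℕ) :
    ContDiffOn ℝ ∞ (coeff χ A.1 α) χ.target := by
  have hy := contMDiffOn_chart_coord hχ
  have h : Set.EqOn (coeff χ A.1 α) (fun x => (∏ i, ((α i).factorial : ℝ))⁻¹ *
      ∑ β ∈ Fintype.piFinset fun i => Finset.range (α i + 1),
        (∏ i, ((-x i) ^ (α i - β i) * ((α i).choose (β i) : ℝ))) *
          localApp A.1 (fun p => ∏ i, χ p i ^ β i) (χ.symm x)) χ.target := fun x hx => by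
    rw [coeff, localApp_prod_sub_pow A χ.open_source hy (χ.map_target hx) (fun i => x i) α]
  refine ContDiffOn.congr ?_ h
  refine contDiffOn_const.mul (ContDiffOn.sum fun β _ => ContDiffOn.mul ?_ ?_)
  · fun_prop
  · refine contDiffOn_comp_chart_symm hχ (contMDiffOn_localApp A χ.open_source ?_)
    exact contMDiffOn_finsetProd fun i _ => (hy i).pow _

theorem contDiffOn_mpd_coeff [T2Space M] [IsManifold (𝓡 n) ∞ M]
    {χ : OpenPartialHomeomorph M (EuclideanSpace ℝ (Fin n))}
    (hχ : χ ∈ IsManifold.maximalAtlas (𝓡 n) ∞ M) (A : DiffOp n k M) (α β : Fin n → ℕ) :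
    ContDiffOn ℝ ∞ (mpd β (coeff χ A.1 α)) χ.target :=
  contDiffOn_mpd χ.open_target (contDiffOn_coeff hχ A α) β

/-! ### The order of a composition -/

theorem hasOrderLE_zero (k : ℕ) : HasOrderLE k (0 : Smooth n M →ₗ[ℝ] Smooth n M) := by
  induction k with
  | zero => intro f; simp [comm]
  | succ k ih =>
    intro f
    have : comm (0 : Smooth n M →ₗ[ℝ] Smooth n M) f = 0 := by simp [comm]
    rw [this]
    exact ih

theorem HasOrderLE.succ {k : ℕ} {A : Smooth n M →ₗ[ℝ] Smooth n M} (h : HasOrderLE k A) :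
    HasOrderLE (k + 1) A := by
  induction k generalizing A with
  | zero =>
    intro f
    rw [h f]
    exact hasOrderLE_zero 0
  | succ k ih => exact fun f => ih (h f)

theorem HasOrderLE.mono {j k : ℕ} (hjk : j ≤ k) {A : Smooth n M →ₗ[ℝ] Smooth n M}
    (h : HasOrderLE j A) : HasOrderLE k A := by
  induction hjk with
  | refl => exact h
  | step _ ih => exact ih.succ

theorem comm_add (A B : Smooth n M →ₗ[ℝ] Smooth n M) (f : Smooth n M) :
    comm (A + B) f = comm A f + comm B f := by
  ext g p
  simp [comm]
  ring

theorem comm_comp (A B : Smooth n M →ₗ[ℝ] Smooth n M) (f : Smooth n M) :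
    comm (A ∘ₗ B) f = A ∘ₗ comm B f + comm A f ∘ₗ B := by
  ext g p
  simp [comm]

theorem HasOrderLE.add {k : ℕ} {A B : Smooth n M →ₗ[ℝ] Smooth n M} (hA : HasOrderLE k A)
    (hB : HasOrderLE k B) : HasOrderLE k (A + B) := by
  induction k generalizing A B with
  | zero =>
    intro f
    rw [comm_add, hA f, hB f, add_zero]
  | succ k ih =>
    intro f
    rw [comm_add]
    exact ih (hA f) (hB f)

theorem hasOrderLE_sum {ι : Type*} {k : ℕ} (s : Finset ι) {A : ι → Smooth n M →ₗ[ℝ] Smooth n M}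
    (hA : ∀ i ∈ s, HasOrderLE k (A i)) : HasOrderLE k (∑ i ∈ s, A i) :=
  Finset.sum_induction A (HasOrderLE k) (fun _ _ => HasOrderLE.add) (hasOrderLE_zero k) hA

theorem HasOrderLE.comp {j k : ℕ} {A B : Smooth n M →ₗ[ℝ] Smooth n M} (hA : HasOrderLE j A)
    (hB : HasOrderLE k B) : HasOrderLE (j + k) (A ∘ₗ B) := by
  induction hN : j + k generalizing j k A B with
  | zero =>
    obtain ⟨rfl, rfl⟩ : j = 0 ∧ k = 0 := by omega
    intro f
    rw [comm_comp, hA f, hB f]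
    simp
  | succ N ih =>
    intro f
    rw [comm_comp]
    refine HasOrderLE.add ?_ ?_
    · cases k with
      | zero =>
        rw [hB f, LinearMap.comp_zero]
        exact hasOrderLE_zero N
      | succ k => exact ih hA (hB f) (by omega)
    · cases j with
      | zero =>
        rw [hA f, LinearMap.zero_comp]
        exact hasOrderLE_zero N
      | succ j => exact ih (hA f) hB (by omega)

theorem hasOrderLE_mulLeft (h : Smooth n M) : HasOrderLE 0 (LinearMap.mulLeft ℝ h) := by
  intro f
  ext g p
  simp [comm]
  ring

theorem hasOrderLE_of_leibniz {X : Smooth n M →ₗ[ℝ] Smooth n M}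
    (hX : ∀ f g, X (f * g) = f * X g + g * X f) : HasOrderLE 1 X := by
  intro f
  have : comm X f = LinearMap.mulLeft ℝ (X f) := by
    ext g p
    simp [comm, hX]
    ring
  rw [this]
  exact hasOrderLE_mulLeft _

theorem hasOrderLE_multiIter {X : Fin n → Smooth n M →ₗ[ℝ] Smooth n M}
    (hX : ∀ i, HasOrderLE 1 (X i)) (β : Fin n → ℕ) :
    HasOrderLE (∑ i, β i) (multiIter (fun i B => X i ∘ₗ B) β LinearMap.id) := by
  rw [← List.sum_ofFn, List.ofFn_eq_map, multiIter]
  induction List.finRange n with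
  | nil =>
    intro f
    ext g p
    simp [comm]
  | cons i L ih =>
    rw [List.map_cons, List.sum_cons, List.foldr_cons]
    generalize β i = b
    induction b with
    | zero => simpa using ih
    | succ b ihb =>
      rw [Function.iterate_succ_apply']
      exact ((hX i).comp ihb).mono (by omega)

end

/-! ### Operators with prescribed jets -/

section

variable {n k : ℕ} {M : Type*} [TopologicalSpace M] [ChartedSpace (EuclideanSpace ℝ (Fin n)) M]
  [T2Space M] [IsManifold (𝓡 n) ∞ M]

/-- The coordinate vector fields of a chart near a point, multiplied by a bump function to become
differential operators on the whole manifold. -/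
theorem exists_cutoff_pd {χ : OpenPartialHomeomorph M (EuclideanSpace ℝ (Fin n))}
    (hχ : χ ∈ IsManifold.maximalAtlas (𝓡 n) ∞ M) {a : M} (ha : a ∈ χ.source) :
    ∃ (X : Fin n → Smooth n M →ₗ[ℝ] Smooth n M) (U : Set M), (∀ i, HasOrderLE 1 (X i)) ∧
      IsOpen U ∧ a ∈ U ∧ U ⊆ χ.source ∧
      ∀ i (G : Smooth n M), ∀ p ∈ U, X i G p = pd i (G ∘ χ.symm) (χ p) := by
  obtain ⟨ρ, -, hρ⟩ := (SmoothBumpFunction.nhds_basis_tsupport (I := 𝓡 n) a).mem_iff.1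
    (χ.open_source.mem_nhds ha)
  have hG : ∀ G : Smooth n M, ContDiffOn ℝ ∞ (G ∘ χ.symm) χ.target := fun G =>
    contDiffOn_comp_chart_symm hχ G.contMDiff.contMDiffOn
  have hd : ∀ (G : Smooth n M) (p : M), ρ p ≠ 0 →
      DifferentiableAt ℝ (G ∘ χ.symm) (χ p) ∧ χ.symm (χ p) = p := fun G p hp => by
    have hp' : p ∈ χ.source := hρ (subset_tsupport _ hp)
    exact ⟨((hG G).contDiffAt (χ.open_target.mem_nhds (χ.map_source hp'))).differentiableAt
      (by simp), χ.left_inv hp'⟩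
  let X : Fin n → Smooth n M →ₗ[ℝ] Smooth n M := fun i =>
    { toFun := fun G => ⟨fun p => ρ p * pd i (G ∘ χ.symm) (χ p),
        contMDiff_of_tsupport fun p hp => by
        have hp' : p ∈ χ.source := hρ (tsupport_mul_subset_left hp)
        exact ρ.contMDiff.contMDiffAt.mul ((contMDiffOn_comp_chart hχ
          (contDiffOn_pd χ.open_target (hG G) i)).contMDiffAt (χ.open_source.mem_nhds hp'))⟩
      map_add' := fun G H => by
        ext p
        change ρ p * pd i ((G ∘ χ.symm) + (H ∘ χ.symm)) (χ p) =
          ρ p * pd i (G ∘ χ.symm) (χ p) + ρ p * pd i (H ∘ χ.symm) (χ p)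
        by_cases hp : ρ p = 0
        · simp [hp]
        · rw [pd_add (hd G p hp).1 (hd H p hp).1, mul_add]
      map_smul' := fun c G => by
        ext p
        change ρ p * pd i (c • (G ∘ χ.symm)) (χ p) = c * (ρ p * pd i (G ∘ χ.symm) (χ p))
        rw [pd_const_smul, mul_left_comm] }
  refine ⟨X, interior {p | ρ p = 1} ∩ χ.source, fun i => hasOrderLE_of_leibniz fun G H => ?_,
    isOpen_interior.inter χ.open_source, ⟨mem_interior_iff_mem_nhds.2 ρ.eventuallyEq_one, ha⟩,
    Set.inter_subset_right, fun i G p hp => ?_⟩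
  · ext p
    change ρ p * pd i ((G ∘ χ.symm) * (H ∘ χ.symm)) (χ p) =
      G p * (ρ p * pd i (H ∘ χ.symm) (χ p)) + H p * (ρ p * pd i (G ∘ χ.symm) (χ p))
    by_cases hp : ρ p = 0
    · simp [hp]
    · rw [pd_mul (hd G p hp).1 (hd H p hp).1]
      simp only [Function.comp_apply, (hd G p hp).2]
      ring
  · have h1 : p ∈ {p | ρ p = 1} := interior_subset hp.1
    change ρ p * _ = _
    rw [show ρ p = 1 from h1, one_mul]

/-- A differential operator with polynomial coefficients in a chart near a given point. -/
theorem exists_diffOp_polynomial_coeff {χ : OpenPartialHomeomorph M (EuclideanSpace ℝ (Fin n))}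
    (hχ : χ ∈ IsManifold.maximalAtlas (𝓡 n) ∞ M) {a : M} (ha : a ∈ χ.source)
    (P : Idx n k → MvPolynomial (Fin n) ℝ) :
    ∃ (A : DiffOp n k M) (U : Set M), IsOpen U ∧ a ∈ U ∧ U ⊆ χ.source ∧
      ∀ (G : Smooth n M), ∀ q ∈ U,
        A.1 G q = ∑ γ, polyAt (χ a) (P γ) (χ q) * mpd γ.1 (G ∘ χ.symm) (χ q) := by
  obtain ⟨X, U, hX, hU, haU, hUχ, hXU⟩ := exists_cutoff_pd hχ ha
  choose h hh using fun γ => exists_smooth_eventuallyEq χ.open_source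
    (contMDiffOn_comp_chart hχ (contDiff_polyAt (χ a) (P γ)).contDiffOn) ha
  obtain ⟨V, hV, hVo, haV⟩ := mem_nhds_iff.1 (Filter.eventually_all.2 hh)
  have hiter : ∀ (G : Smooth n M) (γ : Fin n → ℕ), ∀ q ∈ U,
      multiIter (fun i B => X i ∘ₗ B) γ LinearMap.id G q = mpd γ (G ∘ χ.symm) (χ q) := by
    intro G γ
    refine multiIter_rel (fun (B : Smooth n M →ₗ[ℝ] Smooth n M)
      (g : EuclideanSpace ℝ (Fin n) → ℝ) => ∀ q ∈ U, B G q = g (χ q)) ?_ γ ?_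
    · intro i B g hB q hq
      rw [LinearMap.comp_apply, hXU i _ q hq]
      refine (pd_congr i (comp_chart_symm_eventuallyEq (hUχ hq) ?_)).eq_of_nhds
      filter_upwards [hU.mem_nhds hq] with p hp using hB p hp
    · intro q hq
      simp [χ.left_inv (hUχ hq)]
  refine ⟨⟨∑ γ, LinearMap.mulLeft ℝ (h γ) ∘ₗ multiIter (fun i B => X i ∘ₗ B) γ.1 LinearMap.id,
    hasOrderLE_sum _ fun γ _ => ?_⟩, U ∩ V, hU.inter hVo, ⟨haU, haV⟩,
    Set.inter_subset_left.trans hUχ, fun G q hq => ?_⟩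
  · exact ((hasOrderLE_mulLeft (h γ)).comp (hasOrderLE_multiIter hX γ.1)).mono
      (by simpa using γ.2)
  · rw [LinearMap.sum_apply]
    change ContMDiffMap.coeFnAlgHom (∑ γ, _ : Smooth n M) q = _
    rw [map_sum, Finset.sum_apply]
    refine Finset.sum_congr rfl fun γ _ => ?_
    rw [← hiter G γ.1 q hq.1]
    exact congrArg (· * _) (hV hq.2 γ)

theorem monomial_eq_polyAt (c : EuclideanSpace ℝ (Fin n)) (α : Fin n → ℕ) :
    (fun x : EuclideanSpace ℝ (Fin n) => ∏ i, (x i - c i) ^ α i) =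
      polyAt c (MvPolynomial.monomial (Finsupp.equivFunOnFinite.symm α) 1) := by
  funext x
  simp [polyAt, MvPolynomial.eval_monomial, Finsupp.prod_fintype]

/-- `coeff` recovers the coefficients of an operator given in a chart: all terms but one vanish at
`q` on the monomial `(χ - χ(q))^α`. -/
theorem coeff_eq_polyAt {χ : OpenPartialHomeomorph M (EuclideanSpace ℝ (Fin n))}
    (hχ : χ ∈ IsManifold.maximalAtlas (𝓡 n) ∞ M) {c : EuclideanSpace ℝ (Fin n)}
    {P : Idx n k → MvPolynomial (Fin n) ℝ} {A : DiffOp n k M} {U : Set M} (hUχ : U ⊆ χ.source)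
    (hA : ∀ (G : Smooth n M), ∀ q ∈ U,
      A.1 G q = ∑ γ, polyAt c (P γ) (χ q) * mpd γ.1 (G ∘ χ.symm) (χ q))
    (α : Idx n k) {q : M} (hq : q ∈ U) : coeff χ A.1 α.1 (χ q) = polyAt c (P α) (χ q) := by
  have hq' := hUχ hq
  obtain ⟨G, hG⟩ := exists_smooth_eventuallyEq χ.open_source
    (contMDiffOn_finsetProd (t := Finset.univ) fun i _ =>
      ((contMDiffOn_chart_coord hχ i).sub (contMDiffOn_const (c := χ q i))).pow (α.1 i)) hq'
  rw [coeff, χ.left_inv hq', localApp_eq k A _ q G hG, hA G q hq]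
  have hG' : G ∘ χ.symm =ᶠ[𝓝 (χ q)]
      polyAt (χ q) (MvPolynomial.monomial (Finsupp.equivFunOnFinite.symm α.1) 1) := by
    refine comp_chart_symm_eventuallyEq hq' (hG.trans ?_)
    rw [← monomial_eq_polyAt]
    rfl
  rw [Finset.sum_eq_single α]
  · rw [(mpd_congr α.1 hG').eq_of_nhds, mpd_polyAt_self, MvPolynomial.coeff_monomial, if_pos rfl]
    have : (∏ i, ((α.1 i).factorial : ℝ)) ≠ 0 :=
      Finset.prod_ne_zero_iff.2 fun i _ => by positivity
    field_simp
  · intro γ _ hγ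
    rw [(mpd_congr γ.1 hG').eq_of_nhds, mpd_polyAt_self, MvPolynomial.coeff_monomial, if_neg,
      zero_mul, mul_zero]
    intro h
    exact hγ (Subtype.ext (Finsupp.equivFunOnFinite.symm.injective h).symm)
  · simp

/-- The polynomial of degree at most `r` with given partial derivatives of order at most `r` at the
origin. -/
def taylorPoly {r : ℕ} (u : Idx n r → ℝ) : MvPolynomial (Fin n) ℝ :=
  ∑ β, MvPolynomial.monomial (Finsupp.equivFunOnFinite.symm β.1)
    (u β * (∏ i, ((β.1 i).factorial : ℝ))⁻¹)

theorem mpd_taylorPoly {r : ℕ} (u : Idx n r → ℝ) (c : EuclideanSpace ℝ (Fin n)) (β : Idx n r) :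
    mpd β.1 (polyAt c (taylorPoly u)) c = u β := by
  have : (∏ i, ((β.1 i).factorial : ℝ)) ≠ 0 :=
    Finset.prod_ne_zero_iff.2 fun i _ => by positivity
  rw [mpd_polyAt_self, taylorPoly, MvPolynomial.coeff_sum, Finset.sum_eq_single β]
  · rw [MvPolynomial.coeff_monomial, if_pos rfl]
    field_simp
  · intro γ _ hγ
    rw [MvPolynomial.coeff_monomial, if_neg]
    intro h
    exact hγ (Subtype.ext (Finsupp.equivFunOnFinite.symm.injective h))
  · simp

/-- Any values of the fibre coordinates are attained simultaneously, in two charts that give two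
points the same coordinates, by a pair of operators one of which is the push-forward of the
other. -/
theorem exists_isPushforward_jetCoord_eq
    {χ χ' : OpenPartialHomeomorph M (EuclideanSpace ℝ (Fin n))}
    (hχ : χ ∈ IsManifold.maximalAtlas (𝓡 n) ∞ M) (hχ' : χ' ∈ IsManifold.maximalAtlas (𝓡 n) ∞ M)
    {a a' : M} (ha : a ∈ χ.source) (ha' : a' ∈ χ'.source) (haa' : χ a = χ' a') {r : ℕ}
    (u : Idx n k × Idx n r → ℝ) :
    ∃ (φ : OpenPartialHomeomorph M M) (A B : DiffOp n k M), IsLocalDiffeo (n := n) φ ∧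
      IsPushforward φ A B ∧ a ∈ φ.source ∧ φ a = a' ∧
      jetCoord r χ A a = u ∧ jetCoord r χ' B a' = u := by
  have hjet : ∀ {χ : OpenPartialHomeomorph M (EuclideanSpace ℝ (Fin n))} {a : M} {U : Set M}
      {A : DiffOp n k M}, χ ∈ IsManifold.maximalAtlas (𝓡 n) ∞ M → IsOpen U → a ∈ U →
      U ⊆ χ.source → (∀ (G : Smooth n M), ∀ q ∈ U, A.1 G q =
        ∑ γ, polyAt (χ a) (taylorPoly fun β => u (γ, β)) (χ q) *
          mpd γ.1 (G ∘ χ.symm) (χ q)) → jetCoord r χ A a = u := by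
    intro χ a U A hχ hU haU hUχ hA
    funext αβ
    have h : coeff χ A.1 αβ.1.1 =ᶠ[𝓝 (χ a)]
        polyAt (χ a) (taylorPoly fun β => u (αβ.1, β)) := by
      have hsource := hUχ haU
      filter_upwards [(χ.tendsto_symm hsource).eventually (hU.mem_nhds haU),
        χ.open_target.mem_nhds (χ.map_source hsource)] with x hx hx'
      have := coeff_eq_polyAt hχ hUχ hA αβ.1 hx
      rwa [χ.right_inv hx'] at this
    rw [jetCoord, (mpd_congr αβ.2.1 h).eq_of_nhds, mpd_taylorPoly (fun β => u (αβ.1, β))]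
  obtain ⟨A, U, hU, haU, hUχ, hA⟩ :=
    exists_diffOp_polynomial_coeff hχ ha fun γ => taylorPoly fun β => u (γ, β)
  obtain ⟨B, U', hU', haU', hUχ', hB⟩ :=
    exists_diffOp_polynomial_coeff hχ' ha' fun γ => taylorPoly fun β => u (γ, β)
  -- Both operators have the same coefficients, so that the chart change pushes one to the other.
  let φ := (χ.restrOpen U hU).trans (χ'.restrOpen U' hU').symm
  have hφ : ∀ p, φ p = χ'.symm (χ p) := fun p => rfl
  have hφ' : ∀ p, φ.symm p = χ.symm (χ' p) := fun p => rfl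
  have hsource : ∀ p ∈ φ.source, p ∈ χ.source ∧ p ∈ U ∧ χ p ∈ χ'.target ∧ φ p ∈ U' := by
    intro p hp
    simpa [φ, OpenPartialHomeomorph.trans_source, and_assoc] using hp
  have htarget : ∀ p ∈ φ.target, p ∈ χ'.source ∧ χ' p ∈ χ.target := by
    intro p hp
    have hp' := hsource _ (φ.map_target hp)
    have h2 := φ.right_inv hp
    rw [hφ] at h2
    have h3 := χ'.map_target hp'.2.2.1
    rw [h2] at h3
    refine ⟨h3, ?_⟩
    rw [← h2, χ'.right_inv hp'.2.2.1]
    exact χ.map_source hp'.1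
  have hφa : φ a = a' := by rw [hφ, haa', χ'.left_inv ha']
  refine ⟨φ, A, B, ⟨?_, ?_⟩, fun g p hp => ?_, ?_, hφa, hjet hχ hU haU hUχ hA,
    hjet hχ' hU' haU' hUχ' hB⟩
  · exact ((contMDiffOn_symm_of_mem_maximalAtlas hχ').comp
      ((contMDiffOn_of_mem_maximalAtlas hχ).mono fun p hp => (hsource p hp).1)
      fun p hp => (hsource p hp).2.2.1)
  · exact ((contMDiffOn_symm_of_mem_maximalAtlas hχ).comp
      ((contMDiffOn_of_mem_maximalAtlas hχ').mono fun p hp => (htarget p hp).1)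
      fun p hp => (htarget p hp).2)
  · obtain ⟨h1, h2, h3, h4⟩ := hsource p hp
    have hgφ : g ∘ φ = (g ∘ χ'.symm) ∘ χ := rfl
    obtain ⟨G, hG⟩ := exists_smooth_eventuallyEq (g := g ∘ φ)
      (χ.open_source.inter (φ.open_source))
      (g.contMDiff.comp_contMDiffOn ((contMDiffOn_symm_of_mem_maximalAtlas hχ').comp
        ((contMDiffOn_of_mem_maximalAtlas hχ).mono fun p hp => hp.1)
        fun p hp => (hsource p hp.2).2.2.1)) (a := p) ⟨h1, hp⟩
    have hχφ : χ' (φ p) = χ p := χ'.right_inv h3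
    rw [localApp_eq k A _ p G hG, hA G p h2, hB g _ h4, hχφ, haa']
    refine Finset.sum_congr rfl fun γ _ => ?_
    congr 1
    exact (mpd_congr γ.1 (comp_chart_symm_eventuallyEq h1 hG)).eq_of_nhds.symm
  · have : χ' a' ∈ χ'.target := χ'.map_source ha'
    simp [φ, ha, haU, haa', this, χ'.left_inv ha', haU']

end

/-! ### Charts made of functions with independent differentials -/

section

variable {n : ℕ}

theorem linearMap_apply_eq_sum (w : EuclideanSpace ℝ (Fin n) →ₗ[ℝ] ℝ)
    (x : EuclideanSpace ℝ (Fin n)) : w x = ∑ i, w (EuclideanSpace.single i 1) * x i := by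
  have hx : x = ∑ j, x j • (EuclideanSpace.single j 1 : EuclideanSpace ℝ (Fin n)) := by
    ext i
    simp [Pi.single_apply]
  conv_lhs => rw [hx]
  rw [map_sum]
  exact Finset.sum_congr rfl fun j _ => by rw [map_smul, smul_eq_mul, mul_comm]

/-- A linear endomorphism of Euclidean space with linearly independent components is
invertible. -/
theorem exists_equiv_of_linearIndependent_proj
    (L : EuclideanSpace ℝ (Fin n) →L[ℝ] EuclideanSpace ℝ (Fin n))
    (hL : ∀ t : Fin n → ℝ, (∀ v, ∑ i, t i * L v i = 0) → t = 0) :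
    ∃ L' : EuclideanSpace ℝ (Fin n) ≃L[ℝ] EuclideanSpace ℝ (Fin n),
      (L' : EuclideanSpace ℝ (Fin n) →L[ℝ] EuclideanSpace ℝ (Fin n)) = L := by
  have hsurj : LinearMap.range
      (L : EuclideanSpace ℝ (Fin n) →ₗ[ℝ] EuclideanSpace ℝ (Fin n)) = ⊤ := by
    -- A linear form that vanishes on the range is a relation between the components.
    by_contra h
    obtain ⟨w, hw, hle⟩ := Submodule.exists_le_ker_of_lt_top _ (lt_top_iff_ne_top.2 h)
    have ht := hL (fun i => w (EuclideanSpace.single i 1)) fun v => by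
      rw [← linearMap_apply_eq_sum]
      exact hle (LinearMap.mem_range_self _ v)
    apply hw
    ext x
    rw [linearMap_apply_eq_sum]
    simp [congrFun ht]
  have hinj : LinearMap.ker (L : EuclideanSpace ℝ (Fin n) →ₗ[ℝ] EuclideanSpace ℝ (Fin n)) = ⊥ :=
    LinearMap.ker_eq_bot.2 (LinearMap.injective_iff_surjective.2 (LinearMap.range_eq_top.1 hsurj))
  exact ⟨ContinuousLinearEquiv.ofBijective L hinj hsurj,
    ContinuousLinearEquiv.coe_ofBijective L hinj hsurj⟩

variable {M : Type*} [TopologicalSpace M] [ChartedSpace (EuclideanSpace ℝ (Fin n)) M]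

/-- The differential of a function in the basis of the coordinate differentials of a chart. -/
theorem dAt_eq_sum_pd {χ : OpenPartialHomeomorph M (EuclideanSpace ℝ (Fin n))}
    (hχ : χ ∈ IsManifold.maximalAtlas (𝓡 n) ∞ M) {g : M → ℝ} {p : M} (hp : p ∈ χ.source)
    (hg : DifferentiableAt ℝ (g ∘ χ.symm) (χ p)) :
    dAt (n := n) g p =
      ∑ j, pd j (g ∘ χ.symm) (χ p) • dAt (n := n) (fun q => χ q j) p := by
  have hχd : MDifferentiableAt (𝓡 n) (𝓡 n) χ p :=
    (contMDiffAt_of_mem_maximalAtlas hχ hp).mdifferentiableAt (by simp)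
  obtain ⟨T, hcomp⟩ : ∃ T : TangentSpace (𝓡 n) p → EuclideanSpace ℝ (Fin n),
      ∀ F : EuclideanSpace ℝ (Fin n) → ℝ, DifferentiableAt ℝ F (χ p) →
        ∀ v, dAt (n := n) (F ∘ χ) p v = fderiv ℝ F (χ p) (T v) := by
    refine ⟨fun v => mfderiv (𝓡 n) (𝓡 n) χ p v, fun F hF v => ?_⟩
    rw [dAt, mfderiv_comp p hF.mdifferentiableAt hχd, mfderiv_eq_fderiv]
    rfl
  have hg' : g =ᶠ[𝓝 p] (g ∘ χ.symm) ∘ χ := by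
    filter_upwards [χ.open_source.mem_nhds hp] with q hq
    simp [χ.left_inv hq]
  have h1 : dAt (n := n) g p = dAt (n := n) ((g ∘ χ.symm) ∘ χ) p := hg'.mfderiv_eq
  rw [h1]
  ext v
  rw [hcomp _ hg v]
  have hj : ∀ j, dAt (n := n) (fun q => χ q j) p v = T v j := by
    intro j
    have := hcomp (EuclideanSpace.proj j : EuclideanSpace ℝ (Fin n) →L[ℝ] ℝ)
      (ContinuousLinearMap.differentiableAt _) v
    rw [ContinuousLinearMap.fderiv] at this
    exact this
  rw [sum_apply]
  simp only [smul_apply, hj, smul_eq_mul]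
  rw [← ContinuousLinearMap.coe_coe, linearMap_apply_eq_sum]
  rfl

/-- Functions with linearly independent differentials are, up to additive constants, the
coordinates of a chart. -/
theorem exists_chart_of_linearIndependent_dAt [IsManifold (𝓡 n) ∞ M]
    {y : Fin n → M → ℝ} {U : Set M} (hU : IsOpen U)
    (hy : ∀ i, ContMDiffOn (𝓡 n) 𝓘(ℝ, ℝ) ∞ (y i) U)
    (hind : ∀ p ∈ U, LinearIndependent ℝ fun i => dAt (n := n) (y i) p) {a : M} (ha : a ∈ U)
    (c : Fin n → ℝ) :
    ∃ χ ∈ IsManifold.maximalAtlas (𝓡 n) ∞ M, a ∈ χ.source ∧ χ.source ⊆ U ∧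
      ∀ p ∈ χ.source, ∀ i, χ p i = y i p + c i := by
  let χ₀ := (chartAt (EuclideanSpace ℝ (Fin n)) a).restr U
  have hχ₀ : χ₀ ∈ IsManifold.maximalAtlas (𝓡 n) ∞ M :=
    restr_mem_maximalAtlas _ (IsManifold.chart_mem_maximalAtlas a) hU
  have hχ₀U : χ₀.source ⊆ U := fun p hp => interior_subset hp.2
  have haχ₀ : a ∈ χ₀.source := ⟨mem_chart_source _ a, hU.interior_eq.symm ▸ ha⟩
  have hyx : ∀ i, ContDiffOn ℝ ∞ (y i ∘ χ₀.symm) χ₀.target := fun i =>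
    contDiffOn_comp_chart_symm hχ₀ ((hy i).mono hχ₀U)
  let F : EuclideanSpace ℝ (Fin n) → EuclideanSpace ℝ (Fin n) :=
    fun x => WithLp.toLp 2 fun i => (y i ∘ χ₀.symm) x + c i
  have hF : ContDiffOn ℝ ∞ F χ₀.target := by
    rw [contDiffOn_euclidean]
    exact fun i => (hyx i).add contDiffOn_const
  have hFat : ∀ x ∈ χ₀.target, ContDiffAt ℝ ∞ F x := fun x hx =>
    hF.contDiffAt (χ₀.open_target.mem_nhds hx)
  have hF' : ∀ x ∈ χ₀.target, ∃ L : EuclideanSpace ℝ (Fin n) ≃L[ℝ] EuclideanSpace ℝ (Fin n),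
      HasFDerivAt F (L : EuclideanSpace ℝ (Fin n) →L[ℝ] EuclideanSpace ℝ (Fin n)) x := by
    intro x hx
    have hd := ((hFat x hx).differentiableAt (by simp)).hasFDerivAt
    have hdy : ∀ i, DifferentiableAt ℝ (y i ∘ χ₀.symm) x := fun i =>
      ((hyx i).contDiffAt (χ₀.open_target.mem_nhds hx)).differentiableAt (by simp)
    have hcomp : ∀ i v, fderiv ℝ F x v i = fderiv ℝ (y i ∘ χ₀.symm) x v := by
      intro i v
      have h1 := (EuclideanSpace.proj i : EuclideanSpace ℝ (Fin n) →L[ℝ] ℝ).hasFDerivAt.comp x hd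
      have h2 := (hdy i).hasFDerivAt.add_const (c i)
      exact congrArg (· v) (h1.unique h2)
    obtain ⟨L, hL⟩ := exists_equiv_of_linearIndependent_proj (fderiv ℝ F x) fun t ht => by
      have hp : χ₀.symm x ∈ χ₀.source := χ₀.map_target hx
      have hi := Fintype.linearIndependent_iff.1 (hind _ (hχ₀U hp)) t ?_
      · exact funext hi
      · have hpd : ∀ j, ∑ i, t i * pd j (y i ∘ χ₀.symm) x = 0 := fun j => by
          rw [← ht (EuclideanSpace.single j 1)]
          exact Finset.sum_congr rfl fun i _ => by rw [hcomp]; rfl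
        have hdy' : ∀ i, dAt (n := n) (y i) (χ₀.symm x) = ∑ j, pd j (y i ∘ χ₀.symm) x •
            dAt (n := n) (fun q => χ₀ q j) (χ₀.symm x) := fun i => by
          have := dAt_eq_sum_pd hχ₀ (g := y i) hp (by rw [χ₀.right_inv hx]; exact hdy i)
          rwa [χ₀.right_inv hx] at this
        simp only [hdy', Finset.smul_sum, smul_smul]
        rw [Finset.sum_comm]
        simp only [← Finset.sum_smul, hpd, zero_smul, Finset.sum_const_zero]
    exact ⟨L, hL ▸ hd⟩
  have hx₀ : χ₀ a ∈ χ₀.target := χ₀.map_source haχ₀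
  obtain ⟨L₀, hL₀⟩ := hF' _ hx₀
  -- Restricted to where the derivative is invertible, the local inverse of `F` is smooth.
  let e := ((hFat _ hx₀).toOpenPartialHomeomorph F hL₀ (by simp)).restrOpen χ₀.target
    χ₀.open_target
  have hxe : χ₀ a ∈ e.source :=
    ⟨(hFat _ hx₀).mem_toOpenPartialHomeomorph_source hL₀ (by simp), hx₀⟩
  have hesource : e.source ⊆ χ₀.target := fun x hx => hx.2
  have he : ContDiffOn ℝ ∞ e e.source := hF.mono hesource
  have he' : ContDiffOn ℝ ∞ e.symm e.target := fun x hx => by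
    have hx' := hesource (e.map_target hx)
    obtain ⟨L, hL⟩ := hF' _ hx'
    exact (e.contDiffAt_symm hx hL (hFat _ hx')).contDiffWithinAt
  refine ⟨χ₀.trans e, OpenPartialHomeomorph.mem_maximalAtlas_of_contMDiffOn _ ?_ ?_, ?_, ?_, ?_⟩
  · exact he.contMDiffOn.comp ((contMDiffOn_of_mem_maximalAtlas hχ₀).mono fun p hp => hp.1)
      fun p hp => hp.2
  · exact (contMDiffOn_symm_of_mem_maximalAtlas hχ₀).comp
      (he'.contMDiffOn.mono fun x hx => hx.1) fun x hx => hx.2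
  · exact ⟨haχ₀, hxe⟩
  · exact fun p hp => hχ₀U hp.1
  · intro p hp i
    change y i (χ₀.symm (χ₀ p)) + c i = _
    rw [χ₀.left_inv hp.1]

end

/-! ### Jet coordinates in a chart of invariants -/

section

section JetPolynomials

variable {n k : ℕ}

/-- The formal Tresse derivative `d/dIᵢ` on polynomials in the basic invariants. -/
def tresseDerivation (n k : ℕ) (i : Fin n) :
    Derivation ℝ (MvPolynomial (Fin n ⊕ (Idx n k × List (Fin n))) ℝ)
      (MvPolynomial (Fin n ⊕ (Idx n k × List (Fin n))) ℝ) :=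
  MvPolynomial.mkDerivation ℝ fun
    | Sum.inl j => if i = j then 1 else 0
    | Sum.inr (α, w) => MvPolynomial.X (Sum.inr (α, i :: w))

/-- The coefficient `A_α` in coordinates that differ from `I₁, …, Iₙ` by constants, as a polynomial
in the `Iᵢ` and the `J_β`: the expansion of `(1/α!) A((I - I(q))^α)` at `q`. The condition on `β`
holds for all terms of the sum. -/
def coeffPoly (α : Idx n k) : MvPolynomial (Fin n ⊕ (Idx n k × List (Fin n))) ℝ :=
  MvPolynomial.C (∏ i, ((α.1 i).factorial : ℝ))⁻¹ *
    ∑ β ∈ Fintype.piFinset fun i => Finset.range (α.1 i + 1),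
      (∏ i, ((-MvPolynomial.X (Sum.inl i)) ^ (α.1 i - β i) *
          MvPolynomial.C ((α.1 i).choose (β i) : ℝ))) *
        if h : ∑ i, β i ≤ k then
          MvPolynomial.C (∏ i, ((β i).factorial : ℝ)) * MvPolynomial.X (Sum.inr (⟨β, h⟩, []))
        else 0

/-- The fibre coordinate `u_{α,β}` in coordinates that differ from `I₁, …, Iₙ` by constants, as a
polynomial in the basic invariants. -/
def jetPoly {r : ℕ} (αβ : Idx n k × Idx n r) :
    MvPolynomial (Fin n ⊕ (Idx n k × List (Fin n))) ℝ :=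
  multiIter (fun i => tresseDerivation n k i) αβ.2.1 (coeffPoly αβ.1)

end JetPolynomials

theorem pd_comp_chart_symm_coord {n : ℕ} {M : Type*} [TopologicalSpace M]
    {χ : OpenPartialHomeomorph M (EuclideanSpace ℝ (Fin n))} {y : Fin n → M → ℝ} {c : Fin n → ℝ}
    (hy : ∀ q ∈ χ.source, ∀ i, χ q i = y i q + c i) {q : M} (hq : q ∈ χ.source) (i j : Fin n) :
    DifferentiableAt ℝ (y j ∘ χ.symm) (χ q) ∧
      pd i (y j ∘ χ.symm) (χ q) = if i = j then 1 else 0 := by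
  have h : y j ∘ χ.symm =ᶠ[𝓝 (χ q)] polyAt (WithLp.toLp 2 c) (MvPolynomial.X j) := by
    refine comp_chart_symm_eventuallyEq hq ?_
    filter_upwards [χ.open_source.mem_nhds hq] with p hp
    simp [polyAt, hy p hp j]
  refine ⟨((contDiff_polyAt _ _).differentiable (by simp)).differentiableAt.congr_of_eventuallyEq h,
    ?_⟩
  rw [(pd_congr i h).eq_of_nhds, pd_polyAt, MvPolynomial.pderiv_X]
  by_cases hij : i = j
  · subst hij
    simp [polyAt]
  · simp [polyAt, hij, Ne.symm hij]

variable {n k : ℕ} {M : Type*} [TopologicalSpace M] [ChartedSpace (EuclideanSpace ℝ (Fin n)) M]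
  {I : Fin n → DiffOp n k M → M → ℝ} {A : DiffOp n k M}
  {χ : OpenPartialHomeomorph M (EuclideanSpace ℝ (Fin n))} {c : Fin n → ℝ}

/-- In a chart given by the invariants, the Tresse derivatives are the partial derivatives. -/
theorem tresse_eq_pd (hχ : χ ∈ IsManifold.maximalAtlas (𝓡 n) ∞ M)
    (hI : ∀ q ∈ χ.source, ∀ i, χ q i = I i A q + c i) {q : M} (hq : q ∈ χ.source)
    (hind : LinearIndependent ℝ fun i => dAt (n := n) (I i A) q)
    {f : DiffOp n k M → M → ℝ} (hf : DifferentiableAt ℝ (f A ∘ χ.symm) (χ q)) (i : Fin n) :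
    tresse I i f A q = pd i (f A ∘ χ.symm) (χ q) := by
  have hcoord : ∀ j, dAt (n := n) (fun p => χ p j) q = dAt (n := n) (I j A) q := by
    intro j
    rw [dAt_eq_sum_pd hχ hq (g := I j A)
        (pd_comp_chart_symm_coord (y := fun j => I j A) hI hq j j).1,
      Finset.sum_eq_single j]
    · rw [(pd_comp_chart_symm_coord (y := fun j => I j A) hI hq j j).2, if_pos rfl, one_smul]
    · intro i _ hij
      rw [(pd_comp_chart_symm_coord (y := fun j => I j A) hI hq i j).2, if_neg hij, zero_smul]
    · simp
  have hsum : dAt (n := n) (f A) q =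
      ∑ j, pd j (f A ∘ χ.symm) (χ q) • dAt (n := n) (I j A) q := by
    rw [dAt_eq_sum_pd hχ hq hf]
    exact Finset.sum_congr rfl fun j _ => by rw [hcoord]
  have h : ∃ t : Fin n → ℝ, dAt (n := n) (f A) q = ∑ j, t j • dAt (n := n) (I j A) q :=
    ⟨_, hsum⟩
  rw [tresse, dif_pos h]
  have h0 := Fintype.linearIndependent_iff.1 hind
    (fun j => h.choose j - pd j (f A ∘ χ.symm) (χ q)) (by
      simp only [sub_smul, Finset.sum_sub_distrib]
      rw [← h.choose_spec, ← hsum, sub_self]) i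
  exact sub_eq_zero.1 h0

theorem contMDiffOn_invariant [IsManifold (𝓡 n) ∞ M]
    (hχ : χ ∈ IsManifold.maximalAtlas (𝓡 n) ∞ M)
    (hI : ∀ q ∈ χ.source, ∀ i, χ q i = I i A q + c i) (i : Fin n) :
    ContMDiffOn (𝓡 n) 𝓘(ℝ, ℝ) ∞ (I i A) χ.source :=
  ((contMDiffOn_chart_coord hχ i).sub (contMDiffOn_const (c := c i))).congr fun q hq => by
    change I i A q = χ q i - c i
    rw [hI q hq, add_sub_cancel_right]

variable [T2Space M] [IsManifold (𝓡 n) ∞ M]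

theorem contMDiffOn_basicInvariant (hχ : χ ∈ IsManifold.maximalAtlas (𝓡 n) ∞ M)
    (hI : ∀ q ∈ χ.source, ∀ i, χ q i = I i A q + c i)
    (hind : ∀ q ∈ χ.source, LinearIndependent ℝ fun i => dAt (n := n) (I i A) q)
    (v : Fin n ⊕ (Idx n k × List (Fin n))) :
    ContMDiffOn (𝓡 n) 𝓘(ℝ, ℝ) ∞ (basicInvariant I v A) χ.source := by
  rcases v with i | ⟨α, w⟩
  · exact contMDiffOn_invariant hχ hI i
  · induction w with
    | nil =>
      refine contMDiffOn_const.mul (contMDiffOn_localApp A χ.open_source ?_)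
      exact contMDiffOn_finsetProd fun i _ => (contMDiffOn_invariant hχ hI i).pow _
    | cons i w ih =>
      have hx := contDiffOn_comp_chart_symm hχ ih
      refine (contMDiffOn_comp_chart hχ (contDiffOn_pd χ.open_target hx i)).congr fun q hq => ?_
      exact tresse_eq_pd hχ hI hq (hind q hq) (f := basicInvariant I (Sum.inr (α, w)))
        ((hx.contDiffAt (χ.open_target.mem_nhds (χ.map_source hq))).differentiableAt (by simp)) i

/-- The formal Tresse derivative computes the partial derivatives of polynomials in the basic
invariants. -/
theorem pd_eval_basicInvariant (hχ : χ ∈ IsManifold.maximalAtlas (𝓡 n) ∞ M)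
    (hI : ∀ q ∈ χ.source, ∀ i, χ q i = I i A q + c i)
    (hind : ∀ q ∈ χ.source, LinearIndependent ℝ fun i => dAt (n := n) (I i A) q)
    (p : MvPolynomial (Fin n ⊕ (Idx n k × List (Fin n))) ℝ) {q : M} (hq : q ∈ χ.source)
    (i : Fin n) :
    DifferentiableAt ℝ ((fun q => MvPolynomial.eval (fun v => basicInvariant I v A q) p) ∘ χ.symm)
        (χ q) ∧
      pd i ((fun q => MvPolynomial.eval (fun v => basicInvariant I v A q) p) ∘ χ.symm) (χ q) =
        MvPolynomial.eval (fun v => basicInvariant I v A q) (tresseDerivation n k i p) := by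
  have hd : ∀ v, DifferentiableAt ℝ (basicInvariant I v A ∘ χ.symm) (χ q) := fun v =>
    ((contDiffOn_comp_chart_symm hχ (contMDiffOn_basicInvariant hχ hI hind v)).contDiffAt
      (χ.open_target.mem_nhds (χ.map_source hq))).differentiableAt (by simp)
  induction p using MvPolynomial.induction_on with
  | C a =>
    have h : (fun q => MvPolynomial.eval (fun v => basicInvariant I v A q)
        (MvPolynomial.C a)) ∘ χ.symm = fun _ => a := by
      funext x
      simp
    rw [h]
    exact ⟨differentiableAt_const _, by simp [pd, tresseDerivation]⟩
  | add p₁ p₂ h₁ h₂ =>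
    have h : (fun q => MvPolynomial.eval (fun v => basicInvariant I v A q) (p₁ + p₂)) ∘ χ.symm =
        ((fun q => MvPolynomial.eval (fun v => basicInvariant I v A q) p₁) ∘ χ.symm) +
          ((fun q => MvPolynomial.eval (fun v => basicInvariant I v A q) p₂) ∘ χ.symm) := by
      funext x
      simp
    rw [h]
    exact ⟨h₁.1.add h₂.1, by rw [pd_add h₁.1 h₂.1, h₁.2, h₂.2, map_add, map_add]⟩
  | mul_X p v hp =>
    have h : (fun q => MvPolynomial.eval (fun v => basicInvariant I v A q)
        (p * MvPolynomial.X v)) ∘ χ.symm =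
        ((fun q => MvPolynomial.eval (fun v => basicInvariant I v A q) p) ∘ χ.symm) *
          (basicInvariant I v A ∘ χ.symm) := by
      funext x
      simp
    have hv : pd i (basicInvariant I v A ∘ χ.symm) (χ q) =
        MvPolynomial.eval (fun v => basicInvariant I v A q)
          (tresseDerivation n k i (MvPolynomial.X v)) := by
      rw [tresseDerivation, MvPolynomial.mkDerivation_X]
      rcases v with j | ⟨α, w⟩
      · change pd i (I j A ∘ χ.symm) (χ q) = _
        rw [(pd_comp_chart_symm_coord (y := fun j => I j A) hI hq i j).2]
        split_ifs with hij <;> simp [hij]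
      · rw [MvPolynomial.eval_X]
        exact (tresse_eq_pd hχ hI hq (hind q hq) (f := basicInvariant I (Sum.inr (α, w)))
          (hd _) i).symm
    rw [h]
    refine ⟨hp.1.mul (hd v), ?_⟩
    rw [pd_mul hp.1 (hd v), hp.2, hv, Derivation.leibniz]
    simp [χ.left_inv hq]

theorem localApp_congr {g g' : M → ℝ} {U : Set M} (hU : IsOpen U)
    (hg : ContMDiffOn (𝓡 n) 𝓘(ℝ, ℝ) ∞ g U) (hgg' : Set.EqOn g g' U) {a : M} (ha : a ∈ U) :
    localApp A.1 g a = localApp A.1 g' a := by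
  obtain ⟨G, hG⟩ := exists_smooth_eventuallyEq hU hg ha
  rw [localApp_eq k A g a G hG,
    localApp_eq k A g' a G (hG.trans (hgg'.eventuallyEq_of_mem (hU.mem_nhds ha)))]

theorem coeff_eq_eval_coeffPoly (hχ : χ ∈ IsManifold.maximalAtlas (𝓡 n) ∞ M)
    (hI : ∀ q ∈ χ.source, ∀ i, χ q i = I i A q + c i) (α : Idx n k) {q : M}
    (hq : q ∈ χ.source) :
    coeff χ A.1 α.1 (χ q) =
      MvPolynomial.eval (fun v => basicInvariant I v A q) (coeffPoly α) := by
  have hy := contMDiffOn_invariant hχ hI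
  rw [coeff, χ.left_inv hq, ← localApp_congr (g := fun p => ∏ i, (I i A p - I i A q) ^ α.1 i)
    χ.open_source (contMDiffOn_finsetProd fun i _ => ((hy i).sub contMDiffOn_const).pow _)
    (fun p hp => by simp [hI p hp, hI q hq]) hq,
    localApp_prod_sub_pow A χ.open_source hy hq (fun i => I i A q) α.1, coeffPoly, map_mul,
    MvPolynomial.eval_C, map_sum]
  congr 1
  refine Finset.sum_congr rfl fun β hβ => ?_
  have hβk : ∑ i, β i ≤ k := by
    refine (Finset.sum_le_sum fun i _ => ?_).trans α.2
    have := Fintype.mem_piFinset.1 hβ i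
    rw [Finset.mem_range] at this
    omega
  rw [dif_pos hβk]
  have h0 : (∏ i, ((β i).factorial : ℝ)) ≠ 0 :=
    Finset.prod_ne_zero_iff.2 fun i _ => by positivity
  have hJ : localApp A.1 (fun p => ∏ i, I i A p ^ β i) q =
      (∏ i, ((β i).factorial : ℝ)) * basicInvariant I (Sum.inr (⟨β, hβk⟩, [])) A q :=
    (mul_inv_cancel_left₀ h0 _).symm
  rw [hJ]
  simp [map_prod, basicInvariant]

/-- In a chart given by the invariants, the fibre coordinates of the jet of an operator are fixed
polynomials in the basic invariants. -/
theorem jetCoord_eq_eval_jetPoly (hχ : χ ∈ IsManifold.maximalAtlas (𝓡 n) ∞ M)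
    (hI : ∀ q ∈ χ.source, ∀ i, χ q i = I i A q + c i)
    (hind : ∀ q ∈ χ.source, LinearIndependent ℝ fun i => dAt (n := n) (I i A) q)
    {r : ℕ} {a : M} (ha : a ∈ χ.source) (αβ : Idx n k × Idx n r) :
    jetCoord r χ A a αβ =
      MvPolynomial.eval (fun v => basicInvariant I v A a) (jetPoly αβ) := by
  refine multiIter_rel (fun (g : EuclideanSpace ℝ (Fin n) → ℝ)
    (p : MvPolynomial (Fin n ⊕ (Idx n k × List (Fin n))) ℝ) => ∀ q ∈ χ.source,
      g (χ q) = MvPolynomial.eval (fun v => basicInvariant I v A q) p) ?_ αβ.2.1 ?_ a ha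
  · intro i g p h q hq
    rw [← (pd_eval_basicInvariant hχ hI hind p hq i).2]
    refine (pd_congr i (comp_chart_symm_eventuallyEq hq ?_)).eq_of_nhds.symm
    filter_upwards [χ.open_source.mem_nhds hq] with q' hq' using (h q' hq').symm
  · exact fun q hq => coeff_eq_eval_coeffPoly hχ hI αβ.1 hq

end

/-! ### Invariants along the jets of an operator -/

section

section Restrict

variable {n k l : ℕ} {M : Type*} [TopologicalSpace M] [ChartedSpace (EuclideanSpace ℝ (Fin n)) M]
  [T2Space M] [IsManifold (𝓡 n) ∞ M]

theorem contMDiffOn_jetCoord {χ : OpenPartialHomeomorph M (EuclideanSpace ℝ (Fin n))}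
    (hχ : χ ∈ IsManifold.maximalAtlas (𝓡 n) ∞ M) (A : DiffOp n k M) :
    ContMDiffOn (𝓡 n) 𝓘(ℝ, EuclideanSpace ℝ (Fin n) × (Idx n k × Idx n l → ℝ)) ∞
      (fun p => (χ p, jetCoord l χ A p)) χ.source := by
  refine (ContDiffOn.contMDiffOn (s := χ.target)
    (f := fun x => (x, fun αβ : Idx n k × Idx n l => mpd αβ.2.1 (coeff χ A.1 αβ.1.1) x))
    ?_).comp (contMDiffOn_of_mem_maximalAtlas hχ) χ.mapsTo
  exact contDiffOn_id.prodMk (contDiffOn_pi.2 fun αβ => contDiffOn_mpd_coeff hχ A _ _)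

theorem isOpen_setOf_jet_mem {O : Set (JetSpace n k l M)} (hO : IsOpenJet O) (A : DiffOp n k M) :
    IsOpen {a | jet l A a ∈ O} := by
  refine isOpen_iff_mem_nhds.2 fun a ha => ?_
  have hχ := IsManifold.chart_mem_maximalAtlas (I := 𝓡 n) (n := ∞) a
  obtain ⟨V, hV, h⟩ := hO _ hχ
  have ha' := mem_chart_source (EuclideanSpace ℝ (Fin n)) a
  have hnhds := (chartAt (EuclideanSpace ℝ (Fin n)) a).open_source.mem_nhds ha'
  have hcont := ((contMDiffOn_jetCoord (l := l) hχ A).continuousOn.continuousAt hnhds)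
  filter_upwards [hnhds, hcont.eventually (hV.mem_nhds ((h A a ha').1 ha))] with p hp hpV
  exact (h A p hp).2 hpV

theorem SmoothOnJet.contMDiffOn_restrict {O : Set (JetSpace n k l M)} (hO : IsOpenJet O)
    {f : JetSpace n k l M → ℝ} (hf : SmoothOnJet f O) (A : DiffOp n k M) :
    ContMDiffOn (𝓡 n) 𝓘(ℝ, ℝ) ∞ (restrict f A) {a | jet l A a ∈ O} := by
  intro a ha
  refine ContMDiffAt.contMDiffWithinAt ?_
  have hχ := IsManifold.chart_mem_maximalAtlas (I := 𝓡 n) (n := ∞) a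
  obtain ⟨V, F, hV, hF, h⟩ := hf _ hχ
  have ha' := mem_chart_source (EuclideanSpace ℝ (Fin n)) a
  have hnhds := (chartAt (EuclideanSpace ℝ (Fin n)) a).open_source.mem_nhds ha'
  have hat := (contMDiffOn_jetCoord (l := l) hχ A).contMDiffAt hnhds
  have hFat := (hF.contDiffAt (hV.mem_nhds ((h A a ha').1.1 ha))).contMDiffAt
  refine (hFat.comp a hat).congr_of_eventuallyEq ?_
  filter_upwards [hnhds, (isOpen_setOf_jet_mem hO A).mem_nhds ha] with p hp hpO
  exact (h A p hp).2 hpO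

end Restrict

/-! ### Comparison with one fibre -/

/-- If the fractions `P / Q` and `R * P' / (R * Q')` agree wherever both are defined and `P' / Q'`
is reduced, then `P' / Q'` is defined and agrees with `P / Q` wherever the latter is defined. -/
theorem eval_div_eq_of_isRelPrime {σ : Type*} {P Q P' Q' R : MvPolynomial σ ℝ}
    (hQ : Q ≠ 0) (hR : R ≠ 0) (hQ' : Q' ≠ 0) (hrel : IsRelPrime Q' P')
    (h : ∀ u : σ → ℝ, MvPolynomial.eval u Q ≠ 0 → MvPolynomial.eval u (R * Q') ≠ 0 →
      MvPolynomial.eval u P / MvPolynomial.eval u Q =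
        MvPolynomial.eval u (R * P') / MvPolynomial.eval u (R * Q'))
    {u : σ → ℝ} (hu : MvPolynomial.eval u Q ≠ 0) :
    MvPolynomial.eval u Q' ≠ 0 ∧
      MvPolynomial.eval u P / MvPolynomial.eval u Q =
        MvPolynomial.eval u P' / MvPolynomial.eval u Q' := by
  have heq : P * Q' = P' * Q := by
    -- Multiplied by both denominators, the identity holds at every point.
    have : (P * Q') * (R * (Q * (R * Q'))) = (P' * Q) * (R * (Q * (R * Q'))) := by
      refine MvPolynomial.funext fun u => ?_
      by_cases h1 : MvPolynomial.eval u Q = 0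
      · simp [h1]
      by_cases h2 : MvPolynomial.eval u (R * Q') = 0
      · rw [map_mul, map_mul _ R, map_mul _ Q, h2]
        simp [h2]
      have h3 := (div_eq_div_iff h1 h2).1 (h u h1 h2)
      simp only [map_mul] at h3 ⊢
      linear_combination
        (MvPolynomial.eval u Q * (MvPolynomial.eval u R * MvPolynomial.eval u Q')) * h3
    exact mul_right_cancel₀ (mul_ne_zero hR (mul_ne_zero hQ (mul_ne_zero hR hQ'))) this
  have hu' : MvPolynomial.eval u Q' ≠ 0 := by
    obtain ⟨S, hS⟩ : Q' ∣ Q := hrel.dvd_of_dvd_mul_left ⟨P, by rw [← heq, mul_comm]⟩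
    intro h0
    exact hu (by rw [hS, map_mul, h0, zero_mul])
  refine ⟨hu', (div_eq_div_iff hu hu').2 ?_⟩
  rw [← map_mul, heq, map_mul]

/-- A rational natural invariant is given by the same reduced fraction in the fibre coordinates
over all points, when the charts are such that the points have the same coordinates. -/
theorem IsRationalNaturalInvariant.exists_eval_jetCoord {n k r : ℕ} {M : Type*}
    [TopologicalSpace M] [ChartedSpace (EuclideanSpace ℝ (Fin n)) M] [T2Space M]
    [IsManifold (𝓡 n) ∞ M] {f : JetSpace n k r M → ℝ} {D : Set (JetSpace n k r M)}
    (hf : IsRationalNaturalInvariant f D)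
    {χ₀ : OpenPartialHomeomorph M (EuclideanSpace ℝ (Fin n))}
    (hχ₀ : χ₀ ∈ IsManifold.maximalAtlas (𝓡 n) ∞ M) {a₀ : M} (ha₀ : a₀ ∈ χ₀.source) :
    ∃ P Q : MvPolynomial (Idx n k × Idx n r) ℝ,
      ∀ χ ∈ IsManifold.maximalAtlas (𝓡 n) ∞ M, ∀ a ∈ χ.source, χ a = χ₀ a₀ →
        ∀ A : DiffOp n k M, jet r A a ∈ D →
          MvPolynomial.eval (jetCoord r χ A a) Q ≠ 0 ∧
          f (jet r A a) = MvPolynomial.eval (jetCoord r χ A a) P /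
            MvPolynomial.eval (jetCoord r χ A a) Q := by
  obtain ⟨P₀, Q₀, hQ₀, h₀⟩ := hf.1 χ₀ hχ₀ a₀ ha₀
  obtain ⟨Q, P, R, hrel, hRQ, hRP⟩ :=
    UniqueFactorizationMonoid.exists_reduced_factors Q₀ hQ₀ P₀
  have hR : R ≠ 0 := fun h => hQ₀ (by rw [← hRQ, h, zero_mul])
  have hQ : Q ≠ 0 := fun h => hQ₀ (by rw [← hRQ, h, mul_zero])
  refine ⟨P, Q, fun χ hχ a ha haa₀ A hA => ?_⟩
  obtain ⟨P₁, Q₁, hQ₁, h₁⟩ := hf.1 χ hχ a ha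
  -- Both fractions represent `f` on the jets of operators and their push-forwards.
  have hP₀ : ∀ u : Idx n k × Idx n r → ℝ, MvPolynomial.eval u Q₁ ≠ 0 →
      MvPolynomial.eval u Q₀ ≠ 0 →
      MvPolynomial.eval u P₁ / MvPolynomial.eval u Q₁ =
        MvPolynomial.eval u P₀ / MvPolynomial.eval u Q₀ := by
    intro u hu₁ hu₀
    obtain ⟨φ, B, C, hφ, hBC, haφ, hφa, hB, hC⟩ :=
      exists_isPushforward_jetCoord_eq hχ hχ₀ ha ha₀ haa₀ u
    have hBD := (h₁ B).1.2 (by rwa [hB])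
    have hCD := (h₀ C).1.2 (by rwa [hC])
    have h1 := (h₁ B).2 hBD
    have h2 := (h₀ C).2 hCD
    rw [hB] at h1
    rw [hC] at h2
    rw [← h1, ← h2, hf.2 φ hφ B C hBC a haφ hBD (by rwa [hφa]), hφa]
  have hQ₁A := (h₁ A).1.1 hA
  rw [← hRQ, ← hRP] at hP₀
  obtain ⟨h2, h3⟩ := eval_div_eq_of_isRelPrime hQ₁ hR hQ hrel hP₀ hQ₁A
  exact ⟨h2, ((h₁ A).2 hA).trans h3⟩

end

end NaturalInvariants

end

theorem mainTheorem1 {n k l : ℕ} {M : Type*} [TopologicalSpace M] [T2Space M]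
    [SigmaCompactSpace M] [ConnectedSpace M] [ChartedSpace (EuclideanSpace ℝ (Fin n)) M]
    [IsManifold (𝓡 n) ∞ M]
    (O : Set (JetSpace n k l M)) (hO : IsOpenJet O)
    (I : Fin n → JetSpace n k l M → ℝ)
    (hI : ∀ i, IsNaturalInvariantOn (I i) O)
    (hgen : GeneralPosition I O)
    (r : ℕ) (f : JetSpace n k r M → ℝ) (D : Set (JetSpace n k r M))
    (hf : IsRationalNaturalInvariant f D) :
    ∃ P Q : MvPolynomial (Fin n ⊕ (Idx n k × List (Fin n))) ℝ, Q ≠ 0 ∧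
      ∀ (A : DiffOp n k M) (a : M), jet l A a ∈ O → jet r A a ∈ D →
        MvPolynomial.eval
            (fun v => basicInvariant (fun i => restrict (I i)) v A a) Q ≠ 0 ∧
        f (jet r A a) =
          MvPolynomial.eval
              (fun v => basicInvariant (fun i => restrict (I i)) v A a) P /
            MvPolynomial.eval
              (fun v => basicInvariant (fun i => restrict (I i)) v A a) Q := by
  obtain ⟨a₀⟩ : Nonempty M := inferInstance
  obtain ⟨P, Q, hPQ⟩ := hf.exists_eval_jetCoord
    (IsManifold.chart_mem_maximalAtlas (I := 𝓡 n) (n := ∞) a₀)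
    (mem_chart_source (EuclideanSpace ℝ (Fin n)) a₀)
  have key : ∀ (A : DiffOp n k M) (a : M), jet l A a ∈ O → jet r A a ∈ D →
      MvPolynomial.eval (fun v => basicInvariant (fun i => restrict (I i)) v A a)
          (MvPolynomial.bind₁ jetPoly Q) ≠ 0 ∧
        f (jet r A a) =
          MvPolynomial.eval (fun v => basicInvariant (fun i => restrict (I i)) v A a)
              (MvPolynomial.bind₁ jetPoly P) /
            MvPolynomial.eval (fun v => basicInvariant (fun i => restrict (I i)) v A a)
              (MvPolynomial.bind₁ jetPoly Q) := by
    intro A a haO haD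
    -- The constants give the points `a` and `a₀` the same coordinates.
    obtain ⟨χ, hχ, haχ, hχO, hχI⟩ := exists_chart_of_linearIndependent_dAt
      (isOpen_setOf_jet_mem hO A) (fun i => (hI i).1.contMDiffOn_restrict hO A)
      (fun p hp => hgen A p hp) haO
      (fun i => chartAt (EuclideanSpace ℝ (Fin n)) a₀ a₀ i - restrict (I i) A a)
    have haa₀ : χ a = chartAt (EuclideanSpace ℝ (Fin n)) a₀ a₀ := by
      ext i
      rw [hχI a haχ i, add_sub_cancel]
    have hu : jetCoord r χ A a = fun αβ => MvPolynomial.eval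
        (fun v => basicInvariant (fun i => restrict (I i)) v A a) (jetPoly αβ) :=
      funext fun αβ => jetCoord_eq_eval_jetPoly hχ hχI (fun p hp => hgen A p (hχO hp)) haχ αβ
    have hbind : ∀ p : MvPolynomial (Idx n k × Idx n r) ℝ,
        MvPolynomial.eval (fun v => basicInvariant (fun i => restrict (I i)) v A a)
          (MvPolynomial.bind₁ jetPoly p) = MvPolynomial.eval (jetCoord r χ A a) p := by
      intro p
      rw [hu]
      exact MvPolynomial.eval₂Hom_bind₁ _ _ _ p
    rw [hbind, hbind]
    exact hPQ χ hχ a haχ haa₀ A haD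
  -- If no jet lies over both `O` and `D`, the substituted denominator may be the zero polynomial.
  by_cases hne : ∃ (A : DiffOp n k M) (a : M), jet l A a ∈ O ∧ jet r A a ∈ D
  · obtain ⟨A, a, haO, haD⟩ := hne
    refine ⟨_, _, fun h => (key A a haO haD).1 ?_, key⟩
    rw [h, map_zero]
  · exact ⟨0, 1, one_ne_zero, fun A a haO haD => (hne ⟨A, a, haO, haD⟩).elim⟩
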